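/- Let $m\ge 1$ be an integer, let $\varphi_m=\chi_{[0,1]}*\cdots*\chi_{[0,1]}$ ($m+1$ factors) be the B-spline of degree $m$, and let $V_m=\{\sum_{n\in\mathbb Z}c_n\varphi_m(\cdot-n): c_n\in\mathbb R\}$ be the real spline space, where $(c_n)$ runs over all real sequences. For integers $N_1<N_2$ let $V_m|_{[N_1,N_2]}=\{g\cdot\chi_{[N_1,N_2]}: g\in V_m\}$. A function $f\in V_m|_{[N_1,N_2]}$ is called separable if $f=f_1+f_2$ for some nonzero $f_1,f_2\in V_m|_{[N_1,N_2]}$ with $f_1(x)f_2(x)=0$ for all $x$, and nonseparable otherwise. A set $E\subset[N_1,N_2]$ is called a phaseless sampling set for $V_m|_{[N_1,N_2]}$ if, for every nonseparable $f\in V_m|_{[N_1,N_2]}$ and every $g\in V_m|_{[N_1,N_2]}$ with $|g(x)|=|f(x)|$ for all $x\in E$, one has $g=f$ or $g=-f$. **Theorem.** Let $m\ge1$ and $N_1<N_2$ be integers and let $E\subset[N_1,N_2]$ be a set of points. Then $E$ is a phaseless sampling set for $V_m|_{[N_1,N_2]}$ if and only if the following four conditions hold: 1. $\#E\ge 2(N_2-N_1+m)-1$;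 2. $\#(E\cap[N_1,N_1+k))\ge 2k+m-1$ for all integers $1\le k\le N_2-N_1$; 3. $\#(E\cap(N_2-k,N_2])\ge 2k+m-1$ for all integers $1\le k\le N_2-N_1$; 4. $\#(E\cap(n_1,n_2))\ge 2(n_2-n_1)-1$ for all integers $N_1\le n_1<n_2\le N_2$. Moreover, if $E$ satisfies these four conditions and $f_1,f_2\in V_m$ satisfy $|f_1(x)|=|f_2(x)|$ for all $x\in E$, then $|f_1(x)|=|f_2(x)|$ for all $x\in[N_1,N_2]$. -/

import Mathlib

/-- The B-spline of degree `m`: the convolution of `m + 1` copies of the indicator function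
of `[0, 1]`. -/
noncomputable def bspline : ℕ → ℝ → ℝ
  | 0 => Set.indicator (Set.Icc (0 : ℝ) 1) (fun _ => (1 : ℝ))
  | m + 1 => MeasureTheory.convolution (Set.indicator (Set.Icc (0 : ℝ) 1) (fun _ => (1 : ℝ)))
      (bspline m) (ContinuousLinearMap.mul ℝ ℝ) MeasureTheory.volume

/-- The real spline space `V_m`: all functions `∑ₙ cₙ φ_m(· - n)` with an arbitrary real sequence
`c` indexed by the integers. As `φ_m` has compact support, at every point only finitely many terms
are nonzero. -/
def splineSpace (m : ℕ) : Set (ℝ → ℝ) :=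
  {f | ∃ c : ℤ → ℝ, ∀ x : ℝ, f x = ∑' n : ℤ, c n * bspline m (x - n)}

/-- The restriction `V_m|[N₁, N₂]`: all functions `g · χ_[N₁, N₂]` with `g ∈ V_m`. -/
def restrictedSplineSpace (m : ℕ) (N₁ N₂ : ℤ) : Set (ℝ → ℝ) :=
  {f | ∃ g ∈ splineSpace m, f = Set.indicator (Set.Icc (N₁ : ℝ) N₂) g}

/-- `f` is separable in the function space `H`: it is a sum of two nonzero members of `H` whose
product vanishes identically. -/
def IsSeparableIn (H : Set (ℝ → ℝ)) (f : ℝ → ℝ) : Prop :=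
  ∃ f₁ ∈ H, ∃ f₂ ∈ H, f₁ ≠ 0 ∧ f₂ ≠ 0 ∧ f = f₁ + f₂ ∧ ∀ x, f₁ x * f₂ x = 0

/-- `E` is a phaseless sampling set for the function space `H`: every nonseparable `f ∈ H` is
determined in `H`, up to a sign, by the values of `|f|` on `E`. -/
def IsPhaselessSampling (H : Set (ℝ → ℝ)) (E : Set ℝ) : Prop :=
  ∀ f ∈ H, ¬ IsSeparableIn H f →
    ∀ g ∈ H, (∀ x ∈ E, |g x| = |f x|) → g = f ∨ g = -f

/-- The four counting conditions on `E`. All the integers to which `toNat` is applied are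
positive when `N₁ < N₂`. -/
structure SatisfiesCounting (m : ℕ) (N₁ N₂ : ℤ) (E : Set ℝ) : Prop where
  total : ((2 * (N₂ - N₁ + m) - 1).toNat : ℕ∞) ≤ E.encard
  left : ∀ k : ℤ, 1 ≤ k → k ≤ N₂ - N₁ →
    ((2 * k + m - 1).toNat : ℕ∞) ≤ (E ∩ Set.Ico (N₁ : ℝ) (N₁ + k)).encard
  right : ∀ k : ℤ, 1 ≤ k → k ≤ N₂ - N₁ →
    ((2 * k + m - 1).toNat : ℕ∞) ≤ (E ∩ Set.Ioc ((N₂ : ℝ) - k) N₂).encard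
  inner : ∀ n₁ n₂ : ℤ, N₁ ≤ n₁ → n₁ < n₂ → n₂ ≤ N₂ →
    ((2 * (n₂ - n₁) - 1).toNat : ℕ∞) ≤ (E ∩ Set.Ioo (n₁ : ℝ) n₂).encard

open MeasureTheory Set

/-! Since |f| = |g| means (f + g)(f - g) = 0, phase retrieval is a question about products: does a
product of two splines that vanishes on `E` vanish on all of [N₁, N₂] (`DeterminesProduct`)? If it
does, f = (f + g)/2 + (f - g)/2 separates f unless g = ±f. Conversely, a bad product cd is cut down
to a stretch of knots across which the pair cannot be split; for generic r the spline c + rd is then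
nonseparable there, while c - rd has the same modulus on `E`.

The counting rests on `card_zeros_le`, proved by Rolle and induction on the degree: a spline that is
zero on no knot interval of [a, b] has at most b - a + m - 1 zeros there, and m fewer for each end
at which it vanishes to order m.

Sufficiency: suppose cd is not identically zero, and take a maximal run [a, b] of knot intervals on
which neither factor is zero. At every end of the run inside (N₁, N₂) one factor vanishes to order
m, so together the factors have at most 2(b - a) - 2 + m·#{ends of the run that are ends of [N₁,
N₂]} zeros: one fewer than `E` has points there.

Necessity: take a shortest interval on which the count fails. The points of `E` in it are
distributed between two nonzero splines c and d by linear algebra. Because all shorter intervals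
satisfy the count, the points for c can be spread over the knot intervals so that c is zero on none
of them (`IsSelection.not_zeroOn`); hence cd ≠ 0 somewhere. -/

/-! ### B-splines: recursion, smoothness, support and positivity -/

lemma bspline_zero_apply (x : ℝ) : bspline 0 x = indicator (Icc (0 : ℝ) 1) (fun _ => (1 : ℝ)) x :=
  rfl

lemma bspline_succ (m : ℕ) (x : ℝ) : bspline (m + 1) x = ∫ t in (x - 1)..x, bspline m t := by
  have h : bspline (m + 1) x
      = ∫ t, indicator (Icc (0 : ℝ) 1) (fun t => bspline m (x - t)) t := by
    rw [bspline, convolution_def]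
    refine integral_congr_ae (Filter.Eventually.of_forall fun t => ?_)
    by_cases ht : t ∈ Icc (0 : ℝ) 1 <;> simp [ht]
  rw [h, integral_indicator measurableSet_Icc, integral_Icc_eq_integral_Ioc,
    ← intervalIntegral.integral_of_le zero_le_one, intervalIntegral.integral_comp_sub_left]
  simp

lemma intervalIntegrable_bspline (m : ℕ) (a b : ℝ) : IntervalIntegrable (bspline m) volume a b := by
  induction m generalizing a b with
  | zero =>
    have : Integrable (bspline 0) volume :=
      (integrable_indicator_iff measurableSet_Icc).2 (integrableOn_const (by simp))
    exact this.intervalIntegrable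
  | succ m ih =>
    have h : Continuous (bspline (m + 1)) := by
      have h0 := intervalIntegral.continuous_primitive (fun a b => ih a b) 0
      have : bspline (m + 1) = fun x => (∫ t in (0 : ℝ)..x, bspline m t)
          - ∫ t in (0 : ℝ)..(x - 1), bspline m t := by
        ext x
        rw [bspline_succ, intervalIntegral.integral_interval_sub_left (ih _ _) (ih _ _)]
      rw [this]
      exact h0.sub (h0.comp (continuous_id.sub continuous_const))
    exact h.intervalIntegrable a b

lemma bspline_succ_eq_sub (m : ℕ) (x : ℝ) : bspline (m + 1) x = (∫ t in (0 : ℝ)..x, bspline m t)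
    - ∫ t in (0 : ℝ)..(x - 1), bspline m t := by
  rw [bspline_succ, intervalIntegral.integral_interval_sub_left
    (intervalIntegrable_bspline _ _ _) (intervalIntegrable_bspline _ _ _)]

lemma continuous_bspline {m : ℕ} (hm : 1 ≤ m) : Continuous (bspline m) := by
  obtain ⟨m, rfl⟩ := Nat.exists_eq_add_of_le' hm
  have h0 := intervalIntegral.continuous_primitive (fun a b => intervalIntegrable_bspline m a b) 0
  rw [funext (bspline_succ_eq_sub m)]
  exact h0.sub (h0.comp (continuous_id.sub continuous_const))

lemma hasDerivAt_bspline_succ {m : ℕ} (hm : 1 ≤ m) (x : ℝ) :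
    HasDerivAt (bspline (m + 1)) (bspline m x - bspline m (x - 1)) x := by
  rw [funext (bspline_succ_eq_sub m)]
  have h (y : ℝ) : HasDerivAt (fun x => ∫ t in (0 : ℝ)..x, bspline m t) (bspline m y) y :=
    intervalIntegral.integral_hasDerivAt_right (intervalIntegrable_bspline _ _ _)
      (continuous_bspline hm).stronglyMeasurable.stronglyMeasurableAtFilter
      (continuous_bspline hm).continuousAt
  exact (h x).sub ((h (x - 1)).comp_sub_const x 1)

lemma bspline_nonneg (m : ℕ) (x : ℝ) : 0 ≤ bspline m x := by
  induction m generalizing x with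
  | zero => exact indicator_nonneg (fun _ _ => zero_le_one) x
  | succ m ih =>
    rw [bspline_succ]
    exact intervalIntegral.integral_nonneg (by linarith) fun t _ => ih t

lemma bspline_eq_zero_of_lt (m : ℕ) {x : ℝ} (hx : x < 0 ∨ (m : ℝ) + 1 < x) : bspline m x = 0 := by
  induction m generalizing x with
  | zero =>
    refine indicator_of_notMem (fun h => ?_) _
    rcases hx with hx | hx
    · exact absurd h.1 (not_le.2 hx)
    · exact absurd h.2 (not_le.2 (by simpa using hx))
  | succ m ih =>
    rw [bspline_succ]
    refine intervalIntegral.integral_zero_ae (Filter.Eventually.of_forall fun t ht => ih ?_)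
    rw [uIoc_of_le (by linarith)] at ht
    push_cast at hx
    rcases hx with hx | hx
    · exact Or.inl (by linarith [ht.2])
    · exact Or.inr (by linarith [ht.1])

/-- Continuity adds the end points of the support; this needs m ≥ 1, as the degree-zero spline
equals 1 at both ends. -/
lemma bspline_eq_zero {m : ℕ} (hm : 1 ≤ m) {x : ℝ} (hx : x ≤ 0 ∨ (m : ℝ) + 1 ≤ x) :
    bspline m x = 0 := by
  have hc : IsClosed {x | bspline m x = 0} :=
    isClosed_eq (continuous_bspline hm) continuous_const
  rcases hx with hx | hx
  · have h : Iio (0 : ℝ) ⊆ {x | bspline m x = 0} := fun y hy => bspline_eq_zero_of_lt m (Or.inl hy)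
    have h' := hc.closure_subset_iff.2 h
    rw [closure_Iio] at h'
    exact h' hx
  · have h : Ioi ((m : ℝ) + 1) ⊆ {x | bspline m x = 0} :=
      fun y hy => bspline_eq_zero_of_lt m (Or.inr hy)
    have h' := hc.closure_subset_iff.2 h
    rw [closure_Ioi] at h'
    exact h' hx

lemma bspline_pos (m : ℕ) {x : ℝ} (h0 : 0 < x) (h1 : x < m + 1) : 0 < bspline m x := by
  induction m generalizing x with
  | zero =>
    rw [bspline_zero_apply, indicator_of_mem (show x ∈ Icc (0 : ℝ) 1 from ⟨h0.le, by simpa using h1.le⟩)]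
    exact one_pos
  | succ m ih =>
    rw [bspline_succ]
    push_cast at h1
    have hlt : max (x - 1) 0 < min x (m + 1) := by
      simp only [max_lt_iff, lt_min_iff]
      refine ⟨⟨?_, ?_⟩, ?_, ?_⟩ <;> linarith
    have h := intervalIntegral.intervalIntegral_pos_of_pos_on
      (intervalIntegrable_bspline m (max (x - 1) 0) (min x (m + 1)))
      (fun t ht => ih (lt_of_le_of_lt (le_max_right _ _) ht.1)
        (lt_of_lt_of_le ht.2 (min_le_right _ _))) hlt
    refine h.trans_le (intervalIntegral.integral_mono_interval (le_max_left _ _) hlt.le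
      (min_le_left _ _) (Filter.Eventually.of_forall fun t => bspline_nonneg m t)
      (intervalIntegrable_bspline _ _ _))

lemma bspline_one (x : ℝ) :
    bspline 1 x = volume.real (Ioc (x - 1) x ∩ Icc 0 1) := by
  rw [bspline_succ, intervalIntegral.integral_of_le (by linarith)]
  simp only [bspline_zero_apply]
  rw [setIntegral_indicator measurableSet_Icc, setIntegral_const]
  simp

lemma bspline_one_of_le {x : ℝ} (h0 : 0 ≤ x) (h1 : x ≤ 1) : bspline 1 x = x := by
  rcases h1.lt_or_eq with h1 | rfl
  · rw [bspline_one, show Ioc (x - 1) x ∩ Icc 0 1 = Icc 0 x by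
      ext t; simp only [mem_inter_iff, mem_Ioc, mem_Icc]; constructor
      · rintro ⟨⟨_, _⟩, _, _⟩; constructor <;> linarith
      · rintro ⟨_, _⟩; refine ⟨⟨?_, ?_⟩, ?_, ?_⟩ <;> linarith]
    simp [h0]
  · rw [bspline_one]
    rw [show Ioc ((1 : ℝ) - 1) 1 ∩ Icc 0 1 = Ioc 0 1 by
      rw [sub_self]; exact inter_eq_left.2 Ioc_subset_Icc_self]
    simp

lemma bspline_one_of_ge {x : ℝ} (h1 : 1 ≤ x) (h2 : x ≤ 2) : bspline 1 x = 2 - x := by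
  rw [bspline_one, show Ioc (x - 1) x ∩ Icc 0 1 = Ioc (x - 1) 1 by
    ext t; simp only [mem_inter_iff, mem_Ioc, mem_Icc]; constructor
    · rintro ⟨⟨_, _⟩, _, _⟩; constructor <;> linarith
    · rintro ⟨_, _⟩; refine ⟨⟨?_, ?_⟩, ?_, ?_⟩ <;> linarith]
  rw [Real.volume_real_Ioc_of_le (by linarith)]
  ring

/-! ### Spline sums, their derivatives and local linear independence -/

/-- The spline of degree `m` with the coefficient sequence `c`. -/
noncomputable def splineSum (m : ℕ) (c : ℤ → ℝ) (x : ℝ) : ℝ := ∑' n : ℤ, c n * bspline m (x - n)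

lemma mem_splineSpace {m : ℕ} {f : ℝ → ℝ} : f ∈ splineSpace m ↔ ∃ c, f = splineSum m c :=
  exists_congr fun _ => funext_iff.symm

section
variable {m : ℕ}

lemma splineSum_eq_sum_Icc (hm : 1 ≤ m) (c : ℤ → ℝ) {p q : ℤ} {x : ℝ} (hp : (p : ℝ) + m ≤ x)
    (hq : x ≤ q + 1) : splineSum m c x = ∑ n ∈ Finset.Icc p q, c n * bspline m (x - n) := by
  refine tsum_eq_sum fun n hn => ?_
  rw [bspline_eq_zero hm, mul_zero]
  rw [Finset.mem_Icc, not_and_or, not_le, not_le] at hn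
  rcases hn with hn | hn
  · right
    have : (n : ℝ) + 1 ≤ p := by exact_mod_cast hn
    linarith
  · left
    have : (q : ℝ) + 1 ≤ n := by exact_mod_cast hn
    linarith

lemma summable_splineSum (hm : 1 ≤ m) (c : ℤ → ℝ) (x : ℝ) :
    Summable fun n : ℤ => c n * bspline m (x - n) := by
  refine summable_of_ne_finset_zero (s := Finset.Icc (⌊x⌋ - m) ⌊x⌋) fun n hn => ?_
  rw [bspline_eq_zero hm, mul_zero]
  rw [Finset.mem_Icc, not_and_or, not_le, not_le] at hn
  rcases hn with hn | hn
  · right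
    have : (n : ℝ) + 1 ≤ ⌊x⌋ - m := by exact_mod_cast hn
    linarith [Int.floor_le x]
  · left
    have : (⌊x⌋ : ℝ) + 1 ≤ n := by exact_mod_cast hn
    linarith [Int.lt_floor_add_one x]

lemma splineSum_add (hm : 1 ≤ m) (c d : ℤ → ℝ) (x : ℝ) :
    splineSum m (fun n => c n + d n) x = splineSum m c x + splineSum m d x := by
  simp only [splineSum, add_mul]
  exact (summable_splineSum hm c x).tsum_add (summable_splineSum hm d x)

lemma splineSum_mul (r : ℝ) (c : ℤ → ℝ) (x : ℝ) :
    splineSum m (fun n => r * c n) x = r * splineSum m c x := by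
  simp only [splineSum, mul_assoc]
  exact tsum_mul_left

lemma splineSum_sub (hm : 1 ≤ m) (c d : ℤ → ℝ) (x : ℝ) :
    splineSum m (fun n => c n - d n) x = splineSum m c x - splineSum m d x := by
  simp only [splineSum, sub_mul]
  exact (summable_splineSum hm c x).tsum_sub (summable_splineSum hm d x)

lemma splineSum_diff (hm : 1 ≤ m) (c : ℤ → ℝ) (x : ℝ) :
    splineSum m (fun n => c n - c (n - 1)) x = splineSum m c x - splineSum m c (x - 1) := by
  rw [splineSum_sub hm c (fun n => c (n - 1))]
  congr 1
  rw [splineSum, ← (Equiv.addRight (1 : ℤ)).tsum_eq]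
  refine tsum_congr fun n => ?_
  simp only [Equiv.coe_addRight, add_sub_cancel_right]
  push_cast
  ring_nf

/-- A fixed finite index range near each point lets continuity and differentiability be checked term
by term. -/
lemma splineSum_eventuallyEq (hm : 1 ≤ m) (c : ℤ → ℝ) (x : ℝ) :
    splineSum m c =ᶠ[nhds x] fun y => ∑ n ∈ Finset.Icc (⌊x⌋ - m - 2) (⌊x⌋ + 2),
      c n * bspline m (y - n) := by
  filter_upwards [Ioo_mem_nhds (sub_one_lt x) (lt_add_one x)] with y hy
  refine splineSum_eq_sum_Icc hm c ?_ ?_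
  · push_cast
    linarith [hy.1, Int.floor_le x]
  · push_cast
    linarith [hy.2, Int.lt_floor_add_one x]

lemma continuous_splineSum (hm : 1 ≤ m) (c : ℤ → ℝ) : Continuous (splineSum m c) := by
  refine continuous_iff_continuousAt.2 fun x => ?_
  refine ContinuousAt.congr ?_ (splineSum_eventuallyEq hm c x).symm
  exact (continuous_finsetSum _ fun n _ => continuous_const.mul
    ((continuous_bspline hm).comp (continuous_id.sub continuous_const))).continuousAt

lemma hasDerivAt_splineSum_succ (hm : 1 ≤ m) (c : ℤ → ℝ) (x : ℝ) :
    HasDerivAt (splineSum (m + 1) c) (splineSum m (fun n => c n - c (n - 1)) x) x := by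
  refine HasDerivAt.congr_of_eventuallyEq ?_ (splineSum_eventuallyEq (by omega) c x)
  rw [splineSum_diff hm]
  rw [splineSum_eq_sum_Icc (p := ⌊x⌋ - (m + 1 : ℕ) - 2) (q := ⌊x⌋ + 2) (x := x) hm c
      (by push_cast; linarith [Int.floor_le x]) (by push_cast; linarith [Int.lt_floor_add_one x]),
    splineSum_eq_sum_Icc (p := ⌊x⌋ - (m + 1 : ℕ) - 2) (q := ⌊x⌋ + 2) (x := x - 1) hm c
      (by push_cast; linarith [Int.floor_le x]) (by push_cast; linarith [Int.lt_floor_add_one x]),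
    ← Finset.sum_sub_distrib]
  refine HasDerivAt.fun_sum fun n _ => ?_
  rw [← mul_sub]
  have h := ((hasDerivAt_bspline_succ hm (x - n)).comp_sub_const x (n : ℝ)).const_mul (c n)
  rwa [sub_right_comm] at h

/-- All coefficients that are active on `[n, n + 1]` vanish. -/
def ZeroOn (m : ℕ) (c : ℤ → ℝ) (n : ℤ) : Prop := ∀ j, n - m ≤ j → j ≤ n → c j = 0

lemma splineSum_eq_zero_of_forall (hm : 1 ≤ m) {c : ℤ → ℝ} {x : ℝ}
    (h : ∀ j : ℤ, (j : ℝ) < x → x < j + m + 1 → c j = 0) : splineSum m c x = 0 := by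
  rw [splineSum, ← tsum_zero (β := ℤ)]
  refine tsum_congr fun j => ?_
  by_cases h1 : (j : ℝ) < x
  · by_cases h2 : x < j + m + 1
    · rw [h j h1 h2, zero_mul]
    · rw [bspline_eq_zero hm (Or.inr (by linarith)), mul_zero]
  · rw [bspline_eq_zero hm (Or.inl (by linarith)), mul_zero]

lemma splineSum_congr (hm : 1 ≤ m) {c d : ℤ → ℝ} {x : ℝ}
    (h : ∀ j : ℤ, (j : ℝ) < x → x < j + m + 1 → c j = d j) : splineSum m c x = splineSum m d x := by
  rw [← sub_eq_zero, ← splineSum_sub hm]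
  exact splineSum_eq_zero_of_forall hm fun j h1 h2 => sub_eq_zero.2 (h j h1 h2)

lemma ZeroOn.splineSum_eq_zero (hm : 1 ≤ m) {c : ℤ → ℝ} {n : ℤ} (h : ZeroOn m c n) {x : ℝ}
    (h0 : (n : ℝ) ≤ x) (h1 : x ≤ n + 1) : splineSum m c x = 0 := by
  refine splineSum_eq_zero_of_forall hm fun j hj hj' => h j ?_ ?_
  · have : (n : ℝ) < j + m + 1 := by linarith
    have : n < j + m + 1 := by exact_mod_cast this
    omega
  · have : (j : ℝ) < n + 1 := by linarith
    have : j < n + 1 := by exact_mod_cast this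
    omega

/-- Only m translates are active at a knot, not m + 1. The vanishing of these m coefficients is the
form in which a zero of order m at a knot is used throughout. -/
lemma splineSum_intCast_eq_zero (hm : 1 ≤ m) {c : ℤ → ℝ} {n : ℤ}
    (h : ∀ j, n - m ≤ j → j < n → c j = 0) : splineSum m c n = 0 := by
  refine splineSum_eq_zero_of_forall hm fun j hj hj' => h j ?_ ?_
  · have : n < j + m + 1 := by exact_mod_cast hj'
    omega
  · exact_mod_cast hj

lemma splineSum_one {c : ℤ → ℝ} {n : ℤ} {x : ℝ} (h0 : (n : ℝ) ≤ x) (h1 : x ≤ n + 1) :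
    splineSum 1 c x = c (n - 1) * (n + 1 - x) + c n * (x - n) := by
  rw [splineSum_eq_sum_Icc (p := n - 1) (q := n) le_rfl c (by push_cast; linarith) h1,
    show Finset.Icc (n - 1) n = {n - 1, n} by ext j; simp; omega,
    Finset.sum_pair (by omega), bspline_one_of_ge (by push_cast; linarith) (by push_cast; linarith),
    bspline_one_of_le (by linarith) (by linarith)]
  push_cast
  ring

/-- Local linear independence of the integer translates of a B-spline. -/
lemma zeroOn_of_splineSum_eq_zero (hm : 1 ≤ m) {c : ℤ → ℝ} {n : ℤ} {u v : ℝ} (huv : u < v)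
    (hu : (n : ℝ) ≤ u) (hv : v ≤ n + 1) (h : ∀ x ∈ Ioo u v, splineSum m c x = 0) :
    ZeroOn m c n := by
  induction m, hm using Nat.le_induction generalizing c with
  | base =>
    have e (t : ℝ) (h0 : 0 < t) (h1 : t < 1) :
        c (n - 1) * (n + 1 - (u + t * (v - u))) + c n * (u + t * (v - u) - n) = 0 := by
      rw [← splineSum_one (by nlinarith) (by nlinarith)]
      exact h _ ⟨by nlinarith, by nlinarith⟩
    have e1 := e (1 / 3) (by norm_num) (by norm_num)
    have e2 := e (2 / 3) (by norm_num) (by norm_num)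
    have e3 : (c n - c (n - 1)) * (v - u) = 0 := by linear_combination 3 * e2 - 3 * e1
    have e4 : c n = c (n - 1) := by
      rcases mul_eq_zero.1 e3 with h | h <;> linarith
    have e5 : c (n - 1) = 0 := by rw [e4] at e1; linarith
    intro j h1 h2
    obtain rfl | rfl : j = n - 1 ∨ j = n := by push_cast at h1; omega
    · exact e5
    · rw [e4, e5]
  | succ m hm ih =>
    -- The derivative has the differences of `c` as coefficients, so the induction hypothesis makes
    -- all active coefficients equal; positivity of the B-splines then forces the common value to be
    -- 0.
    have h1 : ZeroOn m (fun n => c n - c (n - 1)) n := by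
      refine ih fun x hx => (hasDerivAt_splineSum_succ hm c x).unique ?_
      refine (hasDerivAt_const x (0 : ℝ)).congr_of_eventuallyEq ?_
      filter_upwards [Ioo_mem_nhds hx.1 hx.2] with y hy using h y hy
    have h2 (k : ℕ) : k ≤ m + 1 → c (n - k) = c n := by
      induction k with
      | zero => simp
      | succ k ihk =>
        intro hk
        have := h1 (n - k) (by omega) (by omega)
        rw [← ihk (by omega), sub_eq_zero.1 this]
        congr 1
        push_cast
        ring
    have h3 : ∀ j, n - (m + 1 : ℕ) ≤ j → j ≤ n → c j = c n := by
      intro j hj hj'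
      have := h2 (n - j).toNat (by omega)
      rwa [Int.toNat_of_nonneg (by omega), sub_sub_cancel] at this
    suffices hc : c n = 0 from fun j hj hj' => (h3 j hj hj').trans hc
    by_contra hc
    have hx : (u + v) / 2 ∈ Ioo u v := ⟨by linarith, by linarith⟩
    have hs := h _ hx
    rw [splineSum_eq_sum_Icc (p := n - (m + 1 : ℕ)) (q := n) (by omega) c
      (by push_cast; linarith [hx.1]) (by linarith [hx.2])] at hs
    rw [Finset.sum_congr rfl (g := fun j : ℤ => c n * bspline (m + 1) ((u + v) / 2 - j))
      fun j hj => by rw [h3 j (Finset.mem_Icc.1 hj).1 (Finset.mem_Icc.1 hj).2],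
      ← Finset.mul_sum] at hs
    refine absurd ((mul_eq_zero.1 hs).resolve_left hc) (Finset.sum_pos (fun j hj => ?_) ?_).ne'
    · obtain ⟨hj1, hj2⟩ := Finset.mem_Icc.1 hj
      have hj1' : (n : ℝ) - (m + 1 : ℕ) ≤ j := by exact_mod_cast hj1
      have hj2' : (j : ℝ) ≤ n := by exact_mod_cast hj2
      refine bspline_pos _ (by linarith [hx.1]) ?_
      linarith [hx.2]
    · exact Finset.nonempty_Icc.2 (by omega)

lemma exists_splineSum_ne_zero (hm : 1 ≤ m) {c : ℤ → ℝ} {n : ℤ} (hc : ¬ ZeroOn m c n) {u v : ℝ}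
    (huv : u < v) (hu : (n : ℝ) ≤ u) (hv : v ≤ n + 1) : ∃ x ∈ Ioo u v, splineSum m c x ≠ 0 := by
  by_contra! h
  exact hc (zeroOn_of_splineSum_eq_zero hm huv hu hv h)

/-- The first spline is nonzero on a whole open subinterval by continuity, and local independence
applies to the second on that subinterval. -/
lemma exists_splineSum_mul_ne_zero (hm : 1 ≤ m) {c d : ℤ → ℝ} {n : ℤ} (hc : ¬ ZeroOn m c n)
    (hd : ¬ ZeroOn m d n) :
    ∃ x ∈ Ioo (n : ℝ) (n + 1), splineSum m c x * splineSum m d x ≠ 0 := by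
  obtain ⟨x, hx, hx0⟩ := exists_splineSum_ne_zero hm hc (lt_add_one (n : ℝ)) le_rfl le_rfl
  have ho : IsOpen (Ioo (n : ℝ) (n + 1) ∩ {y | splineSum m c y ≠ 0}) :=
    isOpen_Ioo.inter ((continuous_splineSum hm c).isOpen_preimage _ isOpen_ne)
  obtain ⟨l, r, hlr, hsub⟩ := mem_nhds_iff_exists_Ioo_subset.1 (ho.mem_nhds ⟨hx, hx0⟩)
  have hlr' : l < r := hlr.1.trans hlr.2
  have hsub' : Ioo l r ⊆ Ioo (n : ℝ) (n + 1) := fun y hy => (hsub hy).1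
  obtain ⟨h1, h2⟩ := (Ioo_subset_Ioo_iff hlr').1 hsub'
  obtain ⟨y, hy, hy0⟩ := exists_splineSum_ne_zero hm hd hlr' h1 h2
  exact ⟨y, hsub' hy, mul_ne_zero (hsub hy).2 hy0⟩

end

/-! ### Counting zeros with Rolle's theorem -/

/-- `ZeroChain f x z n`: there are zeros `x = t₀ < t₁ < ⋯ < tₙ = z` of `f`, and `f` does not vanish
identically between two consecutive ones. -/
inductive ZeroChain (f : ℝ → ℝ) : ℝ → ℝ → ℕ → Prop
  | single {x : ℝ} : f x = 0 → ZeroChain f x x 0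
  | cons {x s y z : ℝ} {n : ℕ} : f x = 0 → x < s → f s ≠ 0 → s < y → ZeroChain f y z n →
      ZeroChain f x z (n + 1)

namespace ZeroChain

variable {f f' : ℝ → ℝ} {x y z s : ℝ} {n : ℕ}

lemma apply_left (h : ZeroChain f x z n) : f x = 0 := by
  cases h <;> assumption

lemma apply_right (h : ZeroChain f x z n) : f z = 0 := by
  induction h <;> assumption

lemma le (h : ZeroChain f x z n) : x ≤ z := by
  induction h with
  | single => exact le_rfl
  | cons _ h1 _ h2 _ ih => linarith

lemma snoc (h : ZeroChain f x y n) (h1 : y < s) (hs : f s ≠ 0) (h2 : s < z) (hz : f z = 0) :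
    ZeroChain f x z (n + 1) := by
  induction h with
  | single hx => exact cons hx h1 hs h2 (single hz)
  | cons a b c d _ ih => exact cons a b c d (ih h1)

lemma exists_deriv_ne_zero (hf : ∀ x, HasDerivAt f (f' x) x) (hxy : x < y) (hne : f x ≠ f y) :
    ∃ s, x < s ∧ s < y ∧ f' s ≠ 0 := by
  obtain ⟨s, hs, h⟩ := exists_hasDerivAt_eq_slope f f' hxy
    (fun t _ => (hf t).continuousAt.continuousWithinAt) fun t _ => hf t
  refine ⟨s, hs.1, hs.2, ?_⟩
  rw [h]
  exact div_ne_zero (sub_ne_zero.2 hne.symm) (by linarith)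

/-- Rolle's theorem, with a zero of the derivative at which the function does not vanish. -/
lemma exists_deriv_eq_zero (hf : ∀ x, HasDerivAt f (f' x) x) (hx : f x = 0) (hy : f y = 0)
    (hxs : x < s) (hs : f s ≠ 0) (hsy : s < y) : ∃ t, x < t ∧ t < y ∧ f' t = 0 ∧ f t ≠ 0 := by
  -- Maximising the square covers both signs of `f`, and its derivative 2 f f' gives f' = 0 because
  -- f ≠ 0 at the maximum.
  have hc : ContinuousOn (fun t => f t ^ 2) (Icc x y) := fun t _ =>
    ((hf t).continuousAt.pow 2).continuousWithinAt
  obtain ⟨t, ht, hmax⟩ := isCompact_Icc.exists_isMaxOn ⟨x, left_mem_Icc.2 (by linarith)⟩ hc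
  have hft : f t ≠ 0 := by
    have h1 : f s ^ 2 ≤ f t ^ 2 := hmax ⟨hxs.le, hsy.le⟩
    have h2 : 0 < f s ^ 2 := by positivity
    intro h
    rw [h] at h1
    linarith
  have htx : x < t := lt_of_le_of_ne ht.1 fun h => hft (h ▸ hx)
  have hty : t < y := lt_of_le_of_ne ht.2 fun h => hft (h ▸ hy)
  have hloc : IsLocalMax (fun t => f t ^ 2) t := hmax.isLocalMax (Icc_mem_nhds htx hty)
  have h0 := hloc.hasDerivAt_eq_zero ((hf t).fun_pow 2)
  refine ⟨t, htx, hty, ?_, hft⟩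
  simpa [hft] using h0

/-- The critical points are chosen where `f` is nonzero. Two successive ones are separated by a zero
of `f`, so the mean value theorem gives a point between them with f' ≠ 0: the chain condition passes
to the derivative. Nonvanishing of `f` at the two extreme ones allows the chain to be extended later
to the end knots. -/
lemma rolle (hf : ∀ x, HasDerivAt f (f' x) x) (h : ZeroChain f x z (n + 1)) :
    ∃ x' z', x < x' ∧ z' < z ∧ f x' ≠ 0 ∧ f z' ≠ 0 ∧ ZeroChain f' x' z' n := by
  induction n generalizing x with
  | zero =>
    cases h with
    | cons hx h1 hs h2 h =>
      cases h with
      | single hy =>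
        obtain ⟨t, ht1, ht2, ht, hft⟩ := exists_deriv_eq_zero hf hx hy h1 hs h2
        exact ⟨t, t, ht1, ht2, hft, hft, single ht⟩
  | succ n ih =>
    cases h with
    | cons hx h1 hs h2 h =>
      obtain ⟨t, ht1, ht2, ht, hft⟩ := exists_deriv_eq_zero hf hx h.apply_left h1 hs h2
      obtain ⟨x', z', hx', hz', hfx', hfz', h'⟩ := ih h
      obtain ⟨s', hs1, hs2, hs'⟩ := exists_deriv_ne_zero hf ht2 (by rwa [h.apply_left])
      exact ⟨t, z', ht1, hz', hft, hfz', cons ht hs1 hs' (hs2.trans hx') h'⟩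

lemma exists_of_finset {F : Finset ℝ} (hF : F.Nonempty) (h0 : ∀ x ∈ F, f x = 0)
    (h1 : ∀ x ∈ F, ∀ y ∈ F, x < y → ∃ s ∈ Ioo x y, f s ≠ 0) :
    ∃ x ∈ F, ∃ z ∈ F, ∃ n, n + 1 = F.card ∧ ZeroChain f x z n ∧ ∀ w ∈ F, x ≤ w ∧ w ≤ z := by
  induction F using Finset.induction_on_max with
  | empty => exact absurd hF (by simp)
  | insert a F ha ih =>
    have haF : a ∉ F := fun h => lt_irrefl _ (ha a h)
    rw [Finset.card_insert_of_notMem haF]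
    rcases F.eq_empty_or_nonempty with rfl | hF'
    · exact ⟨a, by simp, a, by simp, 0, by simp, single (h0 a (by simp)), by simp⟩
    · obtain ⟨x, hx, z, hz, n, hn, hch, hw⟩ := ih hF' (fun x hx => h0 x (by simp [hx]))
        (fun x hx y hy => h1 x (by simp [hx]) y (by simp [hy]))
      obtain ⟨s, hs, hs0⟩ := h1 z (by simp [hz]) a (by simp) (ha z hz)
      refine ⟨x, by simp [hx], a, by simp, n + 1, by omega,
        hch.snoc hs.1 hs0 hs.2 (h0 a (by simp)), fun w hww => ?_⟩
      rcases Finset.mem_insert.1 hww with rfl | hww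
      · exact ⟨(ha x hx).le, le_rfl⟩
      · exact ⟨(hw w hww).1, (ha w hww).le⟩

/-- An affine function with two zeros vanishes between them, so each step of the chain must leave
the current knot interval. -/
lemma length_le_of_splineSum_one {c : ℤ → ℝ} {a b : ℤ} (h : ZeroChain (splineSum 1 c) x z n)
    (ha : (a : ℝ) ≤ x) (hb : z ≤ b) (hab : a < b) : (n : ℤ) + 1 ≤ b - a := by
  induction h generalizing a with
  | single => push_cast; omega
  | @cons x s y z n hx h1 hs h2 h ih =>
    have hy : (a : ℝ) + 1 < y := by
      by_contra! hy
      have e1 := splineSum_one (c := c) ha (by linarith)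
      have e2 := splineSum_one (c := c) (n := a) (x := s) (by linarith) (by linarith)
      have e3 := splineSum_one (c := c) (n := a) (x := y) (by linarith) hy
      rw [hx] at e1
      rw [h.apply_left] at e3
      refine hs ((mul_eq_zero.1 (?_ : (y - x) * _ = 0)).resolve_left (by linarith))
      rw [e2]
      linear_combination (s - y) * e1 + (x - s) * e3
    have hab' : a + 1 < b := by
      have : (a : ℝ) + 1 < b := hy.trans_le (h.le.trans hb)
      exact_mod_cast this
    have := ih (a := a + 1) (by push_cast; exact hy.le) hb hab'
    push_cast
    omega

/-- The bound for the number of zeros of a spline, where a knot `a` at which the spline vanishes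
to order `m` may be prescribed as the first or the last zero. -/
lemma length_le {m : ℕ} (hm : 1 ≤ m) {c : ℤ → ℝ} {a b : ℤ} {l r : Bool}
    (h : ZeroChain (splineSum m c) x z n) (ha : (a : ℝ) ≤ x) (hb : z ≤ b) (hab : a < b)
    (hl : l → x = a ∧ ∀ j, a - m ≤ j → j < a → c j = 0)
    (hr : r → z = b ∧ ∀ j, b - m ≤ j → j < b → c j = 0) :
    (n : ℤ) + 1 ≤ b - a + (m - 1) * (1 - l.toNat - r.toNat) := by
  induction m, hm using Nat.le_induction generalizing c x z n with
  | base =>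
    simpa using length_le_of_splineSum_one h ha hb hab
  | succ m hm ih =>
    have hab' : (a : ℝ) < b := by exact_mod_cast hab
    -- A single zero leaves nothing for Rolle; it cannot lie at both ends, so the factor 1 - l - r
    -- is nonnegative.
    rcases n with - | n
    · have hlr : (l.toNat : ℤ) + r.toNat ≤ 1 := by
        cases l <;> cases r <;> simp
        have hxz : x = z := by cases h; rfl
        rw [(hl rfl).1, (hr rfl).1] at hxz
        linarith
      have : (0 : ℤ) ≤ (((m + 1 : ℕ) : ℤ) - 1) * (1 - l.toNat - r.toNat) :=
        mul_nonneg (by push_cast; omega) (by omega)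
      push_cast at this ⊢
      omega
    · have hf := hasDerivAt_splineSum_succ hm c
      have hx0 := h.apply_left
      have hz0 := h.apply_right
      obtain ⟨x', z', hx', hz', hfx, hfz, h'⟩ := h.rolle hf
      -- Rolle loses one zero, but at a prescribed end the derivative still vanishes to order one
      -- less, and that knot is put back as a zero of the derivative.
      have hL : ∃ x'' , ZeroChain (splineSum m fun n => c n - c (n - 1)) x'' z' (n + l.toNat) ∧
          (a : ℝ) ≤ x'' ∧ (l → x'' = a ∧
            ∀ j, a - m ≤ j → j < a → c j - c (j - 1) = 0) := by
        cases l with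
        | false => exact ⟨x', h', by linarith, by simp⟩
        | true =>
          have hl' := hl rfl
          have hd : ∀ j, a - m ≤ j → j < a → c j - c (j - 1) = 0 := fun j h1 h2 => by
            rw [hl'.2 j (by push_cast; omega) h2, hl'.2 (j - 1) (by push_cast; omega) (by omega),
              sub_zero]
          obtain ⟨s, hs1, hs2, hs⟩ := exists_deriv_ne_zero hf hx' (by rw [hx0]; exact hfx.symm)
          refine ⟨a, cons ?_ (hl'.1 ▸ hs1) hs hs2 h', le_rfl, fun _ => ⟨rfl, hd⟩⟩
          exact splineSum_intCast_eq_zero hm hd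
      obtain ⟨x'', hch, hax, hlx⟩ := hL
      have hR : ∃ z'' , ZeroChain (splineSum m fun n => c n - c (n - 1)) x'' z''
          (n + l.toNat + r.toNat) ∧ z'' ≤ (b : ℝ) ∧ (r → z'' = b ∧
            ∀ j, b - m ≤ j → j < b → c j - c (j - 1) = 0) := by
        cases r with
        | false => exact ⟨z', hch, by linarith, by simp⟩
        | true =>
          have hr' := hr rfl
          have hd : ∀ j, b - m ≤ j → j < b → c j - c (j - 1) = 0 := fun j h1 h2 => by
            rw [hr'.2 j (by push_cast; omega) h2, hr'.2 (j - 1) (by push_cast; omega) (by omega),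
              sub_zero]
          obtain ⟨s, hs1, hs2, hs⟩ := exists_deriv_ne_zero hf hz' (by rwa [hz0])
          refine ⟨b, hch.snoc hs1 hs (hr'.1 ▸ hs2) ?_, le_rfl, fun _ => ⟨rfl, hd⟩⟩
          exact splineSum_intCast_eq_zero hm hd
      obtain ⟨z'', hch', hzb, hrz⟩ := hR
      have := ih hch' hax hzb hlx hrz
      push_cast at this ⊢
      linarith

end ZeroChain

/-! ### The zero bound on an interval between knots -/

section
variable {m : ℕ} {c : ℤ → ℝ} {a b : ℤ}

lemma exists_splineSum_ne_zero_between (hm : 1 ≤ m) (hc : ∀ i, a ≤ i → i < b → ¬ ZeroOn m c i)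
    {x y : ℝ} (hx : (a : ℝ) ≤ x) (hy : y ≤ b) (hxy : x < y) :
    ∃ s ∈ Ioo x y, splineSum m c s ≠ 0 := by
  have h1 : a ≤ ⌊x⌋ := Int.le_floor.2 hx
  have h2 : ⌊x⌋ < b := Int.floor_lt.2 (by linarith)
  obtain ⟨s, hs, hs0⟩ := exists_splineSum_ne_zero hm (hc _ h1 h2)
    (lt_min hxy (Int.lt_floor_add_one x)) (Int.floor_le x) (min_le_right _ _)
  exact ⟨s, ⟨hs.1, hs.2.trans_le (min_le_left _ _)⟩, hs0⟩

/-- A spline that vanishes on no knot interval of `[a, b]` has at most `b - a + m - 1` zeros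
there, and every end point at which it vanishes to order `m` diminishes this bound by `m`. -/
lemma card_zeros_le (hm : 1 ≤ m) (hab : a < b) (hc : ∀ i, a ≤ i → i < b → ¬ ZeroOn m c i)
    {l r : Bool} (hl : l → ∀ j, a - m ≤ j → j < a → c j = 0)
    (hr : r → ∀ j, b - m ≤ j → j < b → c j = 0) (F : Finset ℝ)
    (hF : ∀ x ∈ F, (a : ℝ) ≤ x ∧ x ≤ b ∧ splineSum m c x = 0 ∧ (l → x ≠ a) ∧ (r → x ≠ b)) :
    (F.card : ℤ) ≤ b - a + m - 1 - m * (l.toNat + r.toNat) := by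
  have hab' : (a : ℝ) < b := by exact_mod_cast hab
  -- The prescribed end knots are added to `F`; they use up one zero each, which turns the factor m
  -- - 1 of the chain bound into m.
  obtain ⟨G, hGl, hGr, hGcard, hG⟩ : ∃ G : Finset ℝ, (l → (a : ℝ) ∈ G) ∧
      (r → (b : ℝ) ∈ G) ∧ G.card = F.card + l.toNat + r.toNat ∧
      ∀ x ∈ G, (a : ℝ) ≤ x ∧ x ≤ b ∧ splineSum m c x = 0 := by
    have h1 : l → splineSum m c a = 0 := fun h => splineSum_intCast_eq_zero hm (hl h)
    have h2 : r → splineSum m c b = 0 := fun h => splineSum_intCast_eq_zero hm (hr h)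
    have h3 : l → (a : ℝ) ∉ F := fun h h' => (hF _ h').2.2.2.1 h rfl
    have h4 : r → (b : ℝ) ∉ F := fun h h' => (hF _ h').2.2.2.2 h rfl
    have h5 : ∀ x ∈ F, (a : ℝ) ≤ x ∧ x ≤ b ∧ splineSum m c x = 0 := fun x hx =>
      ⟨(hF x hx).1, (hF x hx).2.1, (hF x hx).2.2.1⟩
    cases l <;> cases r
    · exact ⟨F, by simp, by simp, by simp, h5⟩
    · refine ⟨insert (b : ℝ) F, by simp, by simp, by simp [h4 rfl], ?_⟩
      simpa [h2 rfl, hab'.le] using h5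
    · refine ⟨insert (a : ℝ) F, by simp, by simp, by simp [h3 rfl], ?_⟩
      simpa [h1 rfl, hab'.le] using h5
    · refine ⟨insert (a : ℝ) (insert (b : ℝ) F), by simp, by simp, ?_, ?_⟩
      · rw [Finset.card_insert_of_notMem (by simp [h3 rfl, hab'.ne]),
          Finset.card_insert_of_notMem (h4 rfl)]
        simp
      · simpa [h1 rfl, h2 rfl, hab'.le] using h5
  rcases G.eq_empty_or_nonempty with rfl | hne
  · obtain rfl : l = false := by simpa using hGl
    obtain rfl : r = false := by simpa using hGr
    simp only [Finset.card_empty, Bool.toNat_false, add_zero] at hGcard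
    rw [← hGcard]
    simp only [Bool.toNat_false, Nat.cast_zero, add_zero, mul_zero]
    omega
  · obtain ⟨x, hx, z, hz, n, hn, hch, hw⟩ := ZeroChain.exists_of_finset hne
      (fun x hx => (hG x hx).2.2) fun x hx y hy hxy =>
        exists_splineSum_ne_zero_between hm hc (hG x hx).1 (hG y hy).2.1 hxy
    have := hch.length_le hm (hG x hx).1 (hG z hz).2.1 hab
      (fun h => ⟨le_antisymm (hw _ (hGl h)).1 (hG x hx).1, hl h⟩)
      (fun h => ⟨le_antisymm (hG z hz).2.1 (hw _ (hGr h)).2, hr h⟩)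
    have hn' : (n : ℤ) + 1 = F.card + l.toNat + r.toNat := by
      rw [hGcard] at hn; exact_mod_cast hn
    nlinarith

end

/-! ### The counting conditions and the product property -/

/-- The points between `a` and `b`, where `α` and `β` tell whether `a` and `b` are included. -/
def endSet (a b : ℤ) (α β : Bool) : Set ℝ :=
  {x | (a : ℝ) ≤ x ∧ x ≤ b ∧ (x = a → α) ∧ (x = b → β)}

/-- The four counting conditions in a uniform shape. -/
def Counts (m : ℕ) (N₁ N₂ : ℤ) (E : Set ℝ) : Prop :=
  ∀ (a b : ℤ) (α β : Bool), N₁ ≤ a → a < b → b ≤ N₂ → (α → a = N₁) → (β → b = N₂) →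
    ((2 * (b - a) - 1 + m * (α.toNat + β.toNat) : ℤ).toNat : ℕ∞) ≤ (E ∩ endSet a b α β).encard

/-- If a product of two splines vanishes on `E`, then it vanishes on `[N₁, N₂]`. -/
def DeterminesProduct (m : ℕ) (N₁ N₂ : ℤ) (E : Set ℝ) : Prop :=
  ∀ c d : ℤ → ℝ, (∀ x ∈ E, splineSum m c x * splineSum m d x = 0) →
    ∀ x ∈ Icc (N₁ : ℝ) N₂, splineSum m c x * splineSum m d x = 0

lemma endSet_false_false (a b : ℤ) : endSet a b false false = Ioo (a : ℝ) b := by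
  ext x
  simp only [endSet, mem_ofPred_eq, mem_Ioo, Bool.false_eq_true, imp_false]
  exact ⟨fun h => ⟨lt_of_le_of_ne h.1 (Ne.symm h.2.2.1), lt_of_le_of_ne h.2.1 h.2.2.2⟩,
    fun h => ⟨h.1.le, h.2.le, h.1.ne', h.2.ne⟩⟩

lemma endSet_true_false (a b : ℤ) : endSet a b true false = Ico (a : ℝ) b := by
  ext x
  simp only [endSet, mem_ofPred_eq, mem_Ico, Bool.false_eq_true, imp_false, implies_true, true_and]
  exact ⟨fun h => ⟨h.1, lt_of_le_of_ne h.2.1 h.2.2⟩, fun h => ⟨h.1, h.2.le, h.2.ne⟩⟩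

lemma endSet_false_true (a b : ℤ) : endSet a b false true = Ioc (a : ℝ) b := by
  ext x
  simp only [endSet, mem_ofPred_eq, mem_Ioc, Bool.false_eq_true, imp_false, implies_true, and_true]
  exact ⟨fun h => ⟨lt_of_le_of_ne h.1 (Ne.symm h.2.2), h.2.1⟩, fun h => ⟨h.1.le, h.2, h.1.ne'⟩⟩

lemma endSet_true_true (a b : ℤ) : endSet a b true true = Icc (a : ℝ) b := by
  ext x
  simp [endSet]

lemma satisfiesCounting_iff_counts {m : ℕ} {N₁ N₂ : ℤ} (hN : N₁ < N₂) {E : Set ℝ}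
    (hE : E ⊆ Icc (N₁ : ℝ) N₂) : SatisfiesCounting m N₁ N₂ E ↔ Counts m N₁ N₂ E := by
  constructor
  · intro h a b α β h1 h2 h3 hα hβ
    cases α <;> cases β
    · rw [endSet_false_false]
      convert h.inner a b h1 h2 h3 using 3
      simp
    · rw [endSet_false_true]
      obtain rfl := hβ rfl
      convert h.right (b - a) (by omega) (by omega) using 3
      · simp; ring
      · push_cast; ring_nf
    · rw [endSet_true_false]
      obtain rfl := hα rfl
      convert h.left (b - a) (by omega) (by omega) using 3
      · simp; ring
      · push_cast; ring_nf
    · rw [endSet_true_true]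
      obtain rfl := hα rfl
      obtain rfl := hβ rfl
      rw [inter_eq_left.2 hE]
      convert h.total using 3
      simp; ring
  · intro h
    refine ⟨?_, fun k h1 h2 => ?_, fun k h1 h2 => ?_, fun a b h1 h2 h3 => ?_⟩
    · have := h N₁ N₂ true true le_rfl hN le_rfl (fun _ => rfl) (fun _ => rfl)
      rw [endSet_true_true, inter_eq_left.2 hE] at this
      convert this using 3
      simp; ring
    · have := h N₁ (N₁ + k) true false le_rfl (by omega) (by omega) (fun _ => rfl) (by simp)
      rw [endSet_true_false] at this
      convert this using 3
      · simp; ring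
      · push_cast; ring_nf
    · have := h (N₂ - k) N₂ false true (by omega) (by omega) le_rfl (by simp) (fun _ => rfl)
      rw [endSet_false_true] at this
      convert this using 3
      · simp; ring
      · push_cast; ring_nf
    · have := h a b false false h1 h2 h3 (by simp) (by simp)
      rw [endSet_false_false] at this
      convert this using 3
      simp

/-! ### Maximal runs of knot intervals -/

lemma exists_last_le {T : ℤ → Prop} {N n : ℤ} (h : N ≤ n) :
    ∃ a, N ≤ a ∧ a ≤ n ∧ (a = N ∨ T a) ∧ ∀ q, a < q → q ≤ n → ¬ T q := by
  induction n, h using Int.leInduction with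
  | base => exact ⟨N, le_rfl, le_rfl, Or.inl rfl, fun q h1 h2 => by omega⟩
  | succ n hn ih =>
    by_cases hT : T (n + 1)
    · exact ⟨n + 1, by omega, le_rfl, Or.inr hT, fun q h1 h2 => by omega⟩
    · obtain ⟨a, h1, h2, h3, h4⟩ := ih
      refine ⟨a, h1, by omega, h3, fun q hq hq' => ?_⟩
      rcases hq'.lt_or_eq with hlt | rfl
      · exact h4 q hq (by omega)
      · exact hT

lemma exists_first_gt {T : ℤ → Prop} {n N : ℤ} (h : n < N) :
    ∃ b, n < b ∧ b ≤ N ∧ (b = N ∨ T b) ∧ ∀ q, n < q → q < b → ¬ T q := by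
  obtain ⟨a, h1, h2, h3, h4⟩ := exists_last_le (T := fun q => T (-q)) (N := -N) (n := -n - 1)
    (by omega)
  refine ⟨-a, by omega, by omega, h3.imp_left fun h => by omega, fun q hq hq' => ?_⟩
  have := h4 (-q) (by omega) (by omega)
  rwa [neg_neg] at this

/-- The maximal run of a predicate around `n`, inside `[N₁, N₂)`. -/
lemma exists_maximal_run {Q : ℤ → Prop} {N₁ n N₂ : ℤ} (h1 : N₁ ≤ n) (h2 : n < N₂) (hQ : Q n) :
    ∃ a b, N₁ ≤ a ∧ a ≤ n ∧ n < b ∧ b ≤ N₂ ∧ (∀ i, a ≤ i → i < b → Q i) ∧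
      (a = N₁ ∨ ¬ Q (a - 1)) ∧ (b = N₂ ∨ ¬ Q b) := by
  obtain ⟨a, ha1, ha2, ha3, ha4⟩ := exists_last_le (T := fun q => ¬ Q (q - 1)) h1
  obtain ⟨b, hb1, hb2, hb3, hb4⟩ := exists_first_gt (T := fun q => ¬ Q q) h2
  refine ⟨a, b, ha1, ha2, hb1, hb2, fun i hi hi' => ?_, ha3, hb3⟩
  rcases lt_trichotomy i n with h | rfl | h
  · have := not_not.1 (ha4 (i + 1) (by omega) (by omega))
    rwa [add_sub_cancel_right] at this
  · exact hQ
  · exact not_not.1 (hb4 i h hi')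

lemma exists_knot_interval {N₁ N₂ : ℤ} (hN : N₁ < N₂) {x : ℝ} (hx : x ∈ Icc (N₁ : ℝ) N₂) :
    ∃ n : ℤ, N₁ ≤ n ∧ n < N₂ ∧ (n : ℝ) ≤ x ∧ x ≤ n + 1 := by
  rcases hx.2.lt_or_eq with h | h
  · exact ⟨⌊x⌋, Int.le_floor.2 hx.1, Int.floor_lt.2 h, Int.floor_le x, (Int.lt_floor_add_one x).le⟩
  · exact ⟨N₂ - 1, by omega, by omega, by push_cast; linarith, by push_cast; linarith⟩

/-! ### Sufficiency of the counting conditions -/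

-- On a maximal run where neither factor is identically zero on a knot interval, the zeros of the
-- two factors together are one too few to cover the points of `E`.
open Classical in
theorem Counts.determinesProduct {m : ℕ} (hm : 1 ≤ m) {N₁ N₂ : ℤ} (hN : N₁ < N₂) {E : Set ℝ}
    (h : Counts m N₁ N₂ E) : DeterminesProduct m N₁ N₂ E := by
  intro c d hcd x hx
  by_contra hne
  obtain ⟨n, hn1, hn2, hnx, hxn⟩ := exists_knot_interval hN hx
  obtain ⟨a, b, ha, han, hnb, hb, hQ, hQa, hQb⟩ :=
    exists_maximal_run (Q := fun i => ¬ ZeroOn m c i ∧ ¬ ZeroOn m d i) hn1 hn2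
    ⟨fun h => hne (by rw [h.splineSum_eq_zero hm hnx hxn, zero_mul]),
      fun h => hne (by rw [h.splineSum_eq_zero hm hnx hxn, mul_zero])⟩
  have hab : a < b := han.trans_lt hnb
  obtain ⟨α, hα⟩ : ∃ α : Bool, α = decide (a = N₁) := ⟨_, rfl⟩
  obtain ⟨β, hβ⟩ : ∃ β : Bool, β = decide (b = N₂) := ⟨_, rfl⟩
  have hcount := h a b α β ha hab hb (by simp [hα]) (by simp [hβ])
  obtain ⟨t, ht, htcard⟩ := exists_subset_encard_eq hcount
  have htfin : t.Finite := finite_of_encard_eq_coe htcard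
  obtain ⟨T, rfl⟩ := htfin.exists_finset_coe
  rw [encard_coe_eq_coe_finsetCard, Nat.cast_inj] at htcard
  have hm0 : (0 : ℤ) ≤ m * (α.toNat + β.toNat) := by positivity
  have hT : (T.card : ℤ) = 2 * (b - a) - 1 + m * (α.toNat + β.toNat) := by
    rw [htcard, Int.toNat_of_nonneg (by omega)]
  have hle : T.card ≤ (T.filter fun x => splineSum m c x = 0).card
      + (T.filter fun x => splineSum m d x = 0).card := by
    refine le_trans (Finset.card_le_card fun x hx => ?_) (Finset.card_union_le _ _)
    rw [Finset.mem_union, Finset.mem_filter, Finset.mem_filter]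
    exact (mul_eq_zero.1 (hcd x (ht hx).1)).imp (⟨hx, ·⟩) (⟨hx, ·⟩)
  -- An end of the run is used as a zero of order m only if it is interior to [N₁, N₂]. There the
  -- open end of `endSet` keeps it out of `T`, as the zero bound requires.
  have key (e : ℤ → ℝ) (he : ∀ i, a ≤ i → i < b → ¬ ZeroOn m e i) :=
    card_zeros_le hm hab he (l := !α && decide (ZeroOn m e (a - 1)))
      (r := !β && decide (ZeroOn m e b))
      (fun hl j h1 h2 => by
        simp only [Bool.and_eq_true, decide_eq_true_eq] at hl
        exact hl.2 j (by omega) (by omega))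
      (fun hr j h1 h2 => by
        simp only [Bool.and_eq_true, decide_eq_true_eq] at hr
        exact hr.2 j (by omega) (by omega))
      (T.filter fun x => splineSum m e x = 0) (fun x hx => by
        rw [Finset.mem_filter] at hx
        obtain ⟨h1, h2, h3, h4⟩ := (ht hx.1).2
        refine ⟨h1, h2, hx.2, fun hl hxa => ?_, fun hr hxb => ?_⟩
        · rw [h3 hxa] at hl; simp at hl
        · rw [h4 hxb] at hr; simp at hr)
  have kc := key c fun i h1 h2 => (hQ i h1 h2).1
  have kd := key d fun i h1 h2 => (hQ i h1 h2).2
  -- Maximality: at an interior end one factor is zero on the adjacent knot interval, so at least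
  -- one of the two bounds drops by m.
  have hl : (1 : ℤ) ≤ α.toNat + (!α && decide (ZeroOn m c (a - 1))).toNat
      + (!α && decide (ZeroOn m d (a - 1))).toNat := by
    rcases hQa with h | h
    · simp [hα, h]
    · rw [not_and_or, not_not, not_not] at h
      rcases h with h | h <;> cases α <;> simp [h]
  have hr : (1 : ℤ) ≤ β.toNat + (!β && decide (ZeroOn m c b)).toNat
      + (!β && decide (ZeroOn m d b)).toNat := by
    rcases hQb with h | h
    · simp [hβ, h]
    · rw [not_and_or, not_not, not_not] at h
      rcases h with h | h <;> cases β <;> simp [h]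
  have hle' : (T.card : ℤ) ≤ (T.filter fun x => splineSum m c x = 0).card
      + (T.filter fun x => splineSum m d x = 0).card := by exact_mod_cast hle
  have hmul := mul_le_mul_of_nonneg_left (add_le_add hl hr) (Int.natCast_nonneg m)
  linarith

/-! ### Necessity of the counting conditions -/

/-- More coefficients than prescribed zeros: there is a nonzero spline. -/
lemma exists_coeff_of_card_le (m : ℕ) {A B : ℤ} (U : Finset ℝ) (h : (U.card : ℤ) ≤ B - A) :
    ∃ c : ℤ → ℝ, (∀ j, c j ≠ 0 → A ≤ j ∧ j ≤ B) ∧ (∃ j, c j ≠ 0) ∧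
      ∀ x ∈ U, splineSum m c x = 0 := by
  classical
  let M : Matrix U (Finset.Icc A B) ℝ := Matrix.of fun x j => bspline m ((x : ℝ) - (j : ℤ))
  have hker : LinearMap.ker M.mulVecLin ≠ ⊥ := by
    refine LinearMap.ker_ne_bot_of_finrank_lt ?_
    rw [Module.finrank_fintype_fun_eq_card, Module.finrank_fintype_fun_eq_card, Fintype.card_coe,
      Fintype.card_coe, Int.card_Icc]
    omega
  obtain ⟨w, hw, hw0⟩ := (Submodule.ne_bot_iff _).1 hker
  obtain ⟨j₀, hj₀⟩ := Function.ne_iff.1 hw0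
  refine ⟨fun j => if hj : j ∈ Finset.Icc A B then w ⟨j, hj⟩ else 0, fun j hj => ?_,
    ⟨j₀, ?_⟩, fun x hx => ?_⟩
  · by_contra hj'
    exact hj (dif_neg fun h => hj' (Finset.mem_Icc.1 h))
  · beta_reduce
    rw [dif_pos j₀.2]
    exact hj₀
  · rw [splineSum, tsum_eq_sum (s := Finset.Icc A B) fun j hj => by rw [dif_neg hj, zero_mul],
      ← Finset.sum_coe_sort]
    have := congrFun (LinearMap.mem_ker.1 hw) ⟨x, hx⟩
    rw [Matrix.mulVecLin_apply, Pi.zero_apply, Matrix.mulVec, dotProduct] at this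
    rw [← this]
    refine Finset.sum_congr rfl fun j _ => ?_
    rw [dif_pos j.2, mul_comm]
    rfl

lemma exists_not_zeroOn {m : ℕ} {c : ℤ → ℝ} {a b : ℤ} (hab : a < b)
    (h : ∃ j, c j ≠ 0 ∧ a - m ≤ j ∧ j < b) : ∃ n, a ≤ n ∧ n < b ∧ ¬ ZeroOn m c n := by
  obtain ⟨j, hj, h1, h2⟩ := h
  exact ⟨max j a, le_max_right _ _, max_lt h2 hab,
    fun h => hj (h j (by omega) (le_max_left _ _))⟩

/-- A point `y n` in every knot interval of `[a, b]` but the first one, and a set `X` of points in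
the first one. -/
structure IsSelection (m : ℕ) (a b : ℤ) (α β : Bool) (F X : Finset ℝ) (y : ℤ → ℝ) : Prop where
  mem_endSet : ∀ x ∈ F, x ∈ endSet a b α β
  knot_notMem : ∀ p : ℤ, a < p → p < b → (p : ℝ) ∉ F
  subset : X ⊆ F
  mem : ∀ n, a < n → n < b → y n ∈ F
  lt : ∀ n, a < n → n < b → (n : ℝ) < y n
  le : ∀ n, a < n → n < b → y n ≤ n + 1
  card : a + 1 < b → X.card = m * α.toNat
  first : a + 1 < b → ∀ x ∈ X, x < a + 1

namespace IsSelection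
variable {m : ℕ} {a b : ℤ} {α β : Bool} {F X : Finset ℝ} {y : ℤ → ℝ}

lemma card_image (h : IsSelection m a b α β F X y) {p q : ℤ} (hp : a < p) (hq : q ≤ b) :
    ((Finset.Ico p q).image y).card = (q - p).toNat := by
  rw [Finset.card_image_of_injOn, Int.card_Ico]
  intro i hi j hj hij
  rw [Finset.mem_coe, Finset.mem_Ico] at hi hj
  have h1 := h.lt i (by omega) (by omega)
  have h2 := h.le i (by omega) (by omega)
  have h3 := h.lt j (by omega) (by omega)
  have h4 := h.le j (by omega) (by omega)
  have h5 : (i : ℝ) < j + 1 := by linarith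
  have h6 : (j : ℝ) < i + 1 := by linarith
  have h5' : i < j + 1 := by exact_mod_cast h5
  have h6' : j < i + 1 := by exact_mod_cast h6
  omega

lemma card_union (h : IsSelection m a b α β F X y) {q : ℤ} (hq : q ≤ b) (haq : a < q) :
    ((X ∪ (Finset.Ico (a + 1) q).image y).card : ℤ) = X.card + (q - a - 1) := by
  rw [Finset.card_union_of_disjoint, h.card_image (by omega) hq]
  · push_cast
    rw [Int.toNat_of_nonneg (by omega)]
    ring
  · rw [Finset.disjoint_left]
    intro x hx hx'
    obtain ⟨n, hn, rfl⟩ := Finset.mem_image.1 hx'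
    rw [Finset.mem_Ico] at hn
    have h1 := h.first (by omega) _ hx
    have h2 := h.lt n (by omega) (by omega)
    have h3 : (a : ℝ) + 1 ≤ n := by exact_mod_cast hn.1
    linarith

/-- A nonzero spline that vanishes on the selected points, and to the left of `a` unless `a` is
included, vanishes on no knot interval of `[a, b]`. -/
lemma not_zeroOn (h : IsSelection m a b α β F X y) (hm : 1 ≤ m) (hab : a < b) {c : ℤ → ℝ}
    (hc : ∀ j, c j ≠ 0 → a - m * α.toNat ≤ j ∧ j ≤ b - 1) (hc0 : ∃ j, c j ≠ 0)
    (hz : ∀ x ∈ X ∪ (Finset.Ico (a + 1) b).image y, splineSum m c x = 0) {i : ℤ} (hi : a ≤ i)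
    (hi' : i < b) : ¬ ZeroOn m c i := by
  classical
  obtain ⟨j₀, hj₀⟩ := hc0
  obtain ⟨n, hn1, hn2, hn⟩ := exists_not_zeroOn (m := m) hab ⟨j₀, hj₀, by
    have := (hc j₀ hj₀).1
    cases α <;> simp at this <;> omega, by have := (hc j₀ hj₀).2; omega⟩
  obtain ⟨a', b', ha, han, hnb, hb, hQ, hQa, hQb⟩ :=
    exists_maximal_run (Q := fun i => ¬ ZeroOn m c i) hn1 hn2 hn
  rw [not_not] at hQa hQb
  -- Take a maximal run of knot intervals on which `c` is not zero. If it is shorter than [a, b],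
  -- then `c` vanishes to order m at a proper end, and the selected points in the run exceed the
  -- zero bound.
  suffices hs : a' = a ∧ b' = b from hQ i (by omega) (by omega)
  by_contra hnot
  have hab' : a' < b' := by omega
  -- At `a` itself the order-m zero is available exactly when `α` is false, since `c` then has no
  -- coefficients to the left of `a`.
  obtain ⟨l, hl⟩ : ∃ l : Bool, l = (decide (a < a') || !α) := ⟨_, rfl⟩
  obtain ⟨r, hr⟩ : ∃ r : Bool, r = decide (b' < b) := ⟨_, rfl⟩
  have hlc : l → ∀ j, a' - m ≤ j → j < a' → c j = 0 := by
    intro hl' j h1 h2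
    rcases hQa with h | h
    · by_contra hj
      have := (hc j hj).1
      subst h
      cases α <;> simp [hl] at hl' this
      omega
    · exact h j (by omega) (by omega)
  have hrc : r → ∀ j, b' - m ≤ j → j < b' → c j = 0 := by
    intro hr' j h1 h2
    rw [hr, decide_eq_true_eq] at hr'
    exact (hQb.resolve_left (by omega)) j (by omega) (by omega)
  have key (G : Finset ℝ) (hGU : G ⊆ X ∪ (Finset.Ico (a + 1) b).image y)
      (hG : ∀ x ∈ G, (a' : ℝ) ≤ x ∧ x ≤ b' ∧ (l → x ≠ a')) :
      (G.card : ℤ) ≤ b' - a' + m - 1 - m * (l.toNat + r.toNat) := by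
    refine card_zeros_le hm hab' hQ hlc hrc G fun x hx => ?_
    refine ⟨(hG x hx).1, (hG x hx).2.1, hz x (hGU hx), (hG x hx).2.2, fun hr' hxb => ?_⟩
    rw [hr, decide_eq_true_eq] at hr'
    refine h.knot_notMem b' (by omega) hr' (hxb ▸ ?_)
    rcases Finset.mem_union.1 (hGU hx) with hx | hx
    · exact h.subset hx
    · obtain ⟨n, hn, rfl⟩ := Finset.mem_image.1 hx
      rw [Finset.mem_Ico] at hn
      exact h.mem n (by omega) (by omega)
  have hy (p n : ℤ) (hp : a < p) (hn : n ∈ Finset.Ico p b') :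
      (p : ℝ) < y n ∧ y n ≤ b' := by
    rw [Finset.mem_Ico] at hn
    have h1 := h.lt n (by omega) (by omega)
    have h2 := h.le n (by omega) (by omega)
    have h3 : (p : ℝ) ≤ n := by exact_mod_cast hn.1
    have h4 : (n : ℝ) + 1 ≤ b' := by exact_mod_cast hn.2
    exact ⟨by linarith, by linarith⟩
  by_cases haa : a < a'
  · have := key ((Finset.Ico a' b').image y)
      ((Finset.image_subset_image (Finset.Ico_subset_Ico (by omega) hb)).trans
        Finset.subset_union_right) fun x hx => by
        obtain ⟨n, hn, rfl⟩ := Finset.mem_image.1 hx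
        obtain ⟨h1, h2⟩ := hy a' n haa hn
        exact ⟨h1.le, h2, fun _ => h1.ne'⟩
    rw [h.card_image haa hb, Int.toNat_of_nonneg (by omega), hl, decide_eq_true haa] at this
    simp only [Bool.true_or, Bool.toNat_true] at this
    have h0 : (0 : ℤ) ≤ m * r.toNat := by positivity
    push_cast at this
    linarith
  · obtain rfl : a = a' := by omega
    have hbb : b' < b := by omega
    have := key (X ∪ (Finset.Ico (a + 1) b').image y)
      (Finset.union_subset_union_right
        (Finset.image_subset_image (Finset.Ico_subset_Ico_right hb))) fun x hx => by
        rcases Finset.mem_union.1 hx with hx | hx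
        · obtain ⟨h1, h2, h3, h4⟩ := h.mem_endSet x (h.subset hx)
          have h5 := h.first (by omega) x hx
          have h6 : (a : ℝ) + 1 ≤ b' := by exact_mod_cast hab'
          refine ⟨h1, by linarith, fun hl' hxa => ?_⟩
          rw [hl, h3 hxa] at hl'
          simp at hl'
        · obtain ⟨n, hn, rfl⟩ := Finset.mem_image.1 hx
          obtain ⟨h1, h2⟩ := hy (a + 1) n (by omega) hn
          push_cast at h1
          exact ⟨by linarith, h2, fun _ => by linarith⟩
    rw [h.card_union hb hab', h.card (by omega), hr, decide_eq_true hbb, hl] at this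
    simp only [haa, decide_false, Bool.false_or, Bool.toNat_true] at this
    cases α <;> simp at this <;> omega

end IsSelection

/-- The count fails on [a, b] but holds on the shorter intervals at either end, which pins down the
distribution of `F` closely enough to find a point in each knot interval. The final inequality
leaves few enough points for the second spline. -/
lemma exists_isSelection {m : ℕ} {a b : ℤ} (hab : a < b) {α β : Bool} {F : Finset ℝ}
    (hF : ∀ x ∈ F, x ∈ endSet a b α β)
    (hcard : (F.card : ℤ) ≤ 2 * (b - a) - 2 + m * (α.toNat + β.toNat))
    (hleft : ∀ p : ℤ, a < p → p < b →
      2 * (p - a) - 1 + m * α.toNat ≤ ((F.filter (· < (p : ℝ))).card : ℤ))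
    (hright : ∀ p : ℤ, a < p → p < b →
      2 * (b - p) - 1 + m * β.toNat ≤ ((F.filter ((p : ℝ) < ·)).card : ℤ)) :
    ∃ X y, IsSelection m a b α β F X y ∧ X.card ≤ m * α.toNat ∧
      (F.card : ℤ) ≤ X.card + 2 * (b - a - 1) + m * β.toNat := by
  classical
  have hsum (p : ℤ) : (F.filter (· < (p : ℝ))).card + (F.filter ((p : ℝ) < ·)).card
      + (F.filter ((p : ℝ) = ·)).card = F.card := by
    rw [← Finset.card_union_of_disjoint, ← Finset.card_union_of_disjoint]
    · congr 1
      ext x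
      simp only [Finset.mem_union, Finset.mem_filter]
      have := lt_trichotomy (p : ℝ) x
      tauto
    · rw [Finset.disjoint_left]
      intro x hx hx'
      simp only [Finset.mem_union, Finset.mem_filter] at hx hx'
      rcases hx with hx | hx <;> linarith [hx.2, hx'.2]
    · rw [Finset.disjoint_left]
      intro x hx hx'
      simp only [Finset.mem_filter] at hx hx'
      linarith [hx.2, hx'.2]
  -- The lower bounds left and right of `p` already add up to the upper bound for the size of `F`.
  have hknot : ∀ p : ℤ, a < p → p < b → (p : ℝ) ∉ F := by
    intro p h1 h2 hp
    have h3 := hleft p h1 h2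
    have h4 := hright p h1 h2
    have h5 := hsum p
    have h6 : 0 < (F.filter ((p : ℝ) = ·)).card :=
      Finset.card_pos.2 ⟨p, Finset.mem_filter.2 ⟨hp, rfl⟩⟩
    zify at h5 h6
    linarith
  have hright' (p : ℤ) (h1 : a < p) (h2 : p < b) :
      ((F.filter ((p : ℝ) < ·)).card : ℤ) ≤ 2 * (b - p) - 1 + m * β.toNat := by
    have h3 := hleft p h1 h2
    have h5 := hsum p
    zify at h5
    have h6 : (0 : ℤ) ≤ (F.filter ((p : ℝ) = ·)).card := by positivity
    linarith
  -- Without a point in (n, n + 1], the lower bound to the right of n would contradict the upper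
  -- bound to the right of n + 1.
  have hy (n : ℤ) : ∃ t : ℝ, a < n → n < b → t ∈ F ∧ (n : ℝ) < t ∧ t ≤ n + 1 := by
    by_cases hn : a < n ∧ n < b
    · by_contra! hnot
      have hsub : F.filter ((n : ℝ) < ·) ⊆ F.filter (((n + 1 : ℤ) : ℝ) < ·) := by
        intro x hx
        rw [Finset.mem_filter] at hx ⊢
        obtain ⟨_, _, h3⟩ := hnot x
        push_cast
        exact ⟨hx.1, h3 hx.1 hx.2⟩
      have h1 := Int.ofNat_le.2 (Finset.card_le_card hsub)
      have h2 := hright n hn.1 hn.2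
      rcases (show n + 1 ≤ b by omega).lt_or_eq with h3 | h3
      · have h4 := hright' (n + 1) (by omega) h3
        linarith
      · have h4 : F.filter (((n + 1 : ℤ) : ℝ) < ·) = ∅ := by
          refine Finset.filter_false_of_mem fun x hx => ?_
          rw [h3, not_lt]
          exact (hF x hx).2.1
        rw [h4, Finset.card_empty] at h1
        have h5 : (0 : ℤ) ≤ m * β.toNat := by positivity
        push_cast at h1
        linarith
    · exact ⟨0, fun h1 h2 => absurd ⟨h1, h2⟩ hn⟩
  choose y hy using hy
  by_cases hab1 : a + 1 < b
  · have h1 := hleft (a + 1) (by omega) hab1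
    obtain ⟨X, hX, hXc⟩ := Finset.exists_subset_card_eq
      (s := F.filter (· < ((a + 1 : ℤ) : ℝ))) (n := m * α.toNat)
      (Int.ofNat_le.1 (by rw [Nat.cast_mul]; linarith))
    refine ⟨X, y, ⟨hF, hknot, hX.trans (Finset.filter_subset _ _), fun n h1 h2 => (hy n h1 h2).1,
      fun n h1 h2 => (hy n h1 h2).2.1, fun n h1 h2 => (hy n h1 h2).2.2, fun _ => hXc,
      fun _ x hx => ?_⟩, hXc.le, ?_⟩
    · have := (Finset.mem_filter.1 (hX hx)).2
      push_cast at this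
      exact this
    · rw [hXc]
      push_cast
      linarith
  -- On a single knot interval no lower bound for `F` is known, so `X` takes as many points as there
  -- are, up to m · `α.toNat`.
  · obtain rfl : b = a + 1 := by omega
    obtain ⟨X, hX, hXc⟩ := Finset.exists_subset_card_eq (s := F) (min_le_right (m * α.toNat) F.card)
    refine ⟨X, y, ⟨hF, hknot, hX, fun n h1 h2 => (hy n h1 h2).1,
      fun n h1 h2 => (hy n h1 h2).2.1, fun n h1 h2 => (hy n h1 h2).2.2, fun h => absurd h hab1,
      fun h => absurd h hab1⟩, hXc ▸ min_le_left _ _, ?_⟩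
    rw [hXc]
    push_cast
    have h0 : (0 : ℤ) ≤ m * β.toNat := by positivity
    rcases le_total ((m : ℤ) * α.toNat) F.card with h | h
    · rw [min_eq_left h]
      linarith
    · rw [min_eq_right h]
      linarith

/-- Strong induction on b - a makes a failing interval minimal. Splitting its points between two
splines gives a product that is zero on `E` but not on [N₁, N₂]. -/
theorem DeterminesProduct.counts {m : ℕ} (hm : 1 ≤ m) {N₁ N₂ : ℤ} {E : Set ℝ}
    (hE : E ⊆ Icc (N₁ : ℝ) N₂) (h : DeterminesProduct m N₁ N₂ E) : Counts m N₁ N₂ E := by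
  classical
  intro a b α β
  induction hk : (b - a).toNat using Nat.strong_induction_on generalizing a b α β with
  | _ k ih =>
  intro ha hab hb hα hβ
  by_contra! hlt
  have hfin : (E ∩ endSet a b α β).Finite := finite_of_encard_le_coe hlt.le
  obtain ⟨F, hF⟩ := hfin.exists_finset_coe
  have hmemF (x : ℝ) : x ∈ F ↔ x ∈ E ∧ x ∈ endSet a b α β := by
    rw [← Finset.mem_coe, hF, mem_inter_iff]
  rw [← hF, encard_coe_eq_coe_finsetCard, Nat.cast_lt] at hlt
  have hcard : (F.card : ℤ) ≤ 2 * (b - a) - 2 + m * (α.toNat + β.toNat) := by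
    have := Int.lt_toNat.1 hlt
    omega
  have of_counts (G : Finset ℝ) (z : ℤ) (S : Set ℝ) (h1 : (z.toNat : ℕ∞) ≤ S.encard)
      (h2 : S ⊆ G) : z ≤ G.card := by
    have h3 := h1.trans (encard_le_encard h2)
    rw [encard_coe_eq_coe_finsetCard, Nat.cast_le] at h3
    exact Int.toNat_le.1 h3
  have hleft : ∀ p : ℤ, a < p → p < b →
      2 * (p - a) - 1 + m * α.toNat ≤ ((F.filter (· < (p : ℝ))).card : ℤ) := by
    intro p h1 h2
    have h2' : (p : ℝ) < b := by exact_mod_cast h2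
    refine of_counts _ _ (E ∩ endSet a p α false) ?_ fun x ⟨hxE, h3, h4, h5, h6⟩ => ?_
    · have := ih _ (by omega) a p α false rfl ha h1 (by omega) hα (by simp)
      simpa using this
    · have h7 : x ≠ p := fun h => by simpa using h6 h
      have h8 : x < p := lt_of_le_of_ne h4 h7
      rw [Finset.mem_coe, Finset.mem_filter, hmemF]
      exact ⟨⟨hxE, h3, by linarith, h5, fun h => by linarith⟩, h8⟩
  have hright : ∀ p : ℤ, a < p → p < b →
      2 * (b - p) - 1 + m * β.toNat ≤ ((F.filter ((p : ℝ) < ·)).card : ℤ) := by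
    intro p h1 h2
    have h1' : (a : ℝ) < p := by exact_mod_cast h1
    refine of_counts _ _ (E ∩ endSet p b false β) ?_ fun x ⟨hxE, h3, h4, h5, h6⟩ => ?_
    · have := ih _ (by omega) p b false β rfl (by omega) h2 hb (by simp) hβ
      simpa using this
    · have h7 : x ≠ p := fun h => by simpa using h5 h
      have h8 : (p : ℝ) < x := lt_of_le_of_ne h3 h7.symm
      rw [Finset.mem_coe, Finset.mem_filter, hmemF]
      exact ⟨⟨hxE, by linarith, h4, fun h => by linarith, h6⟩, h8⟩
  obtain ⟨X, y, hsel, hX, hFX⟩ := exists_isSelection hab (fun x hx => ((hmemF x).1 hx).2) hcard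
    hleft hright
  set U := X ∪ (Finset.Ico (a + 1) b).image y with hU
  have hUcard : (U.card : ℤ) = X.card + (b - a - 1) := hsel.card_union le_rfl hab
  have hUF : U ⊆ F := by
    refine Finset.union_subset hsel.subset fun x hx => ?_
    obtain ⟨n, hn, rfl⟩ := Finset.mem_image.1 hx
    rw [Finset.mem_Ico] at hn
    exact hsel.mem n (by omega) (by omega)
  have hdiff : (((F \ U).card : ℕ) : ℤ) = F.card - U.card := by
    rw [Finset.card_sdiff_of_subset hUF, Nat.cast_sub (Finset.card_le_card hUF)]
  -- The index ranges make `c` vanish left of `a` when `α` is false, and `d` vanish right of `b`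
  -- when `β` is false. This takes care of the points of `E` outside `F`; each included end is paid
  -- for by m further coefficients.
  obtain ⟨c, hc, hc0, hcz⟩ := exists_coeff_of_card_le m (A := a - m * α.toNat) (B := b - 1) U (by
    zify at hX
    linarith)
  obtain ⟨d, hd, ⟨j, hj⟩, hdz⟩ := exists_coeff_of_card_le m (A := a - m)
    (B := b - 1 - m + m * β.toNat) (F \ U) (by linarith)
  have hd' : ∀ j, d j ≠ 0 → a - m ≤ j ∧ j < b := fun j hj => by
    have := hd j hj
    cases β <;> simp at this <;> omega
  obtain ⟨n, hn1, hn2, hdn⟩ := exists_not_zeroOn hab ⟨j, hj, hd' j hj⟩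
  obtain ⟨x, hx, hx0⟩ := exists_splineSum_mul_ne_zero hm
    (hsel.not_zeroOn hm hab hc hc0 hcz hn1 hn2) hdn
  have hczero (hα' : α = false) (x : ℝ) (hx : x ≤ a) : splineSum m c x = 0 := by
    refine splineSum_eq_zero_of_forall hm fun j hj1 _ => ?_
    by_contra hj
    have h1 := (hc j hj).1
    simp only [hα', Bool.toNat_false, Nat.cast_zero, mul_zero, sub_zero] at h1
    have h2 : (a : ℝ) ≤ j := by exact_mod_cast h1
    linarith
  have hdzero (hβ' : β = false) (x : ℝ) (hx : (b : ℝ) ≤ x) : splineSum m d x = 0 := by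
    refine splineSum_eq_zero_of_forall hm fun j _ hj2 => ?_
    by_contra hj
    have h1 := (hd j hj).2
    simp only [hβ', Bool.toNat_false, Nat.cast_zero, mul_zero, add_zero] at h1
    have h2 : (j : ℝ) ≤ b - 1 - m := by exact_mod_cast h1
    linarith
  refine hx0 (h c d (fun t ht => ?_) x ?_)
  · by_cases htF : t ∈ F
    · by_cases htU : t ∈ U
      · rw [hcz t htU, zero_mul]
      · rw [hdz t (Finset.mem_sdiff.2 ⟨htF, htU⟩), mul_zero]
    · by_cases h1 : α = false ∧ t ≤ a
      · rw [hczero h1.1 t h1.2, zero_mul]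
      by_cases h2 : β = false ∧ (b : ℝ) ≤ t
      · rw [hdzero h2.1 t h2.2, mul_zero]
      refine absurd ((hmemF t).2 ⟨ht, ?_, ?_, fun h => ?_, fun h => ?_⟩) htF
      · cases α
        · simp at h1
          exact h1.le
        · rw [hα rfl]
          exact (hE ht).1
      · cases β
        · simp at h2
          exact h2.le
        · rw [hβ rfl]
          exact (hE ht).2
      · cases α
        · exact absurd ⟨rfl, h.le⟩ h1
        · rfl
      · cases β
        · exact absurd ⟨rfl, h.ge⟩ h2
        · rfl
  · have h1 : (N₁ : ℝ) ≤ n := by exact_mod_cast ha.trans hn1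
    have h2 : (n : ℝ) + 1 ≤ N₂ := by exact_mod_cast (show n + 1 ≤ N₂ by omega)
    exact ⟨by linarith [hx.1], by linarith [hx.2]⟩

/-! ### Phaseless sampling and the product property -/

lemma mem_restrictedSplineSpace {m : ℕ} {N₁ N₂ : ℤ} {f : ℝ → ℝ} :
    f ∈ restrictedSplineSpace m N₁ N₂ ↔
      ∃ c, f = indicator (Icc (N₁ : ℝ) N₂) (splineSum m c) := by
  simp only [restrictedSplineSpace, mem_ofPred_eq, mem_splineSpace]
  exact ⟨fun ⟨_, ⟨c, hc⟩, h⟩ => ⟨c, hc ▸ h⟩, fun ⟨c, h⟩ => ⟨_, ⟨c, rfl⟩, h⟩⟩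

lemma abs_eq_abs_iff_mul_eq_zero {x y : ℝ} : |x| = |y| ↔ (x + y) * (x - y) = 0 := by
  rw [← sq_eq_sq_iff_abs_eq_abs, ← sub_eq_zero, sq_sub_sq]

theorem DeterminesProduct.abs_eq_abs {m : ℕ} (hm : 1 ≤ m) {N₁ N₂ : ℤ} {E : Set ℝ}
    (h : DeterminesProduct m N₁ N₂ E) {c d : ℤ → ℝ}
    (hcd : ∀ x ∈ E, |splineSum m c x| = |splineSum m d x|) :
    ∀ x ∈ Icc (N₁ : ℝ) N₂, |splineSum m c x| = |splineSum m d x| := by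
  intro x hx
  rw [abs_eq_abs_iff_mul_eq_zero, ← splineSum_add hm, ← splineSum_sub hm]
  refine h _ _ (fun y hy => ?_) x hx
  rw [splineSum_add hm, splineSum_sub hm, ← abs_eq_abs_iff_mul_eq_zero]
  exact hcd y hy

theorem DeterminesProduct.isPhaselessSampling {m : ℕ} (hm : 1 ≤ m) {N₁ N₂ : ℤ} {E : Set ℝ}
    (hE : E ⊆ Icc (N₁ : ℝ) N₂) (h : DeterminesProduct m N₁ N₂ E) :
    IsPhaselessSampling (restrictedSplineSpace m N₁ N₂) E := by
  intro f hf hns g hg hfg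
  obtain ⟨c, rfl⟩ := mem_restrictedSplineSpace.1 hf
  obtain ⟨d, rfl⟩ := mem_restrictedSplineSpace.1 hg
  have habs := h.abs_eq_abs hm (c := c) (d := d) fun x hx => by
    have := hfg x hx
    rw [indicator_of_mem (hE hx), indicator_of_mem (hE hx)] at this
    exact this.symm
  by_contra! hne
  refine hns ⟨_, mem_restrictedSplineSpace.2 ⟨fun n => 1 / 2 * (c n + d n), rfl⟩,
    _, mem_restrictedSplineSpace.2 ⟨fun n => 1 / 2 * (c n - d n), rfl⟩, ?_, ?_, ?_, ?_⟩
  · intro h0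
    refine hne.2 (funext fun x => ?_)
    by_cases hx : x ∈ Icc (N₁ : ℝ) N₂
    · have := congrFun h0 x
      rw [indicator_of_mem hx, splineSum_mul, splineSum_add hm, Pi.zero_apply] at this
      rw [Pi.neg_apply, indicator_of_mem hx, indicator_of_mem hx]
      linarith
    · rw [Pi.neg_apply, indicator_of_notMem hx, indicator_of_notMem hx, neg_zero]
  · intro h0
    refine hne.1 (funext fun x => ?_)
    by_cases hx : x ∈ Icc (N₁ : ℝ) N₂
    · have := congrFun h0 x
      rw [indicator_of_mem hx, splineSum_mul, splineSum_sub hm, Pi.zero_apply] at this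
      rw [indicator_of_mem hx, indicator_of_mem hx]
      linarith
    · rw [indicator_of_notMem hx, indicator_of_notMem hx]
  · ext x
    by_cases hx : x ∈ Icc (N₁ : ℝ) N₂
    · rw [Pi.add_apply, indicator_of_mem hx, indicator_of_mem hx, indicator_of_mem hx,
        splineSum_mul, splineSum_mul, splineSum_sub hm, splineSum_add hm]
      ring
    · rw [Pi.add_apply, indicator_of_notMem hx, indicator_of_notMem hx, indicator_of_notMem hx,
        add_zero]
  · intro x
    by_cases hx : x ∈ Icc (N₁ : ℝ) N₂
    · rw [indicator_of_mem hx, indicator_of_mem hx, splineSum_mul, splineSum_mul, splineSum_sub hm,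
        splineSum_add hm]
      have := abs_eq_abs_iff_mul_eq_zero.1 (habs x hx)
      linear_combination 1 / 4 * this
    · rw [indicator_of_notMem hx, zero_mul]

/-- Each index excludes at most one nonzero value of r. -/
lemma exists_ne_zero_forall_add_mul_ne_zero (s : Finset ℤ) (c d : ℤ → ℝ) :
    ∃ r : ℝ, r ≠ 0 ∧ ∀ j ∈ s, c j + r * d j = 0 → c j = 0 ∧ d j = 0 := by
  classical
  obtain ⟨r, hr⟩ := Infinite.exists_notMem_finset (insert 0 (s.image fun j => -c j / d j))
  rw [Finset.mem_insert, not_or] at hr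
  refine ⟨r, hr.1, fun j hj h => ?_⟩
  have hd : d j = 0 := by
    by_contra hd
    refine hr.2 (Finset.mem_image.2 ⟨j, hj, ?_⟩)
    rw [div_eq_iff hd]
    linarith
  exact ⟨by simpa [hd] using h, hd⟩

/-- From a product that vanishes on `E` but not everywhere, the pair c + rd, c - rd is built after
cutting, so that the first member is nonseparable. -/
theorem IsPhaselessSampling.determinesProduct {m : ℕ} (hm : 1 ≤ m) {N₁ N₂ : ℤ} (hN : N₁ < N₂)
    {E : Set ℝ} (hE : E ⊆ Icc (N₁ : ℝ) N₂)
    (h : IsPhaselessSampling (restrictedSplineSpace m N₁ N₂) E) :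
    DeterminesProduct m N₁ N₂ E := by
  intro c d hcd x₀ hx₀
  by_contra hne
  obtain ⟨n, hn1, hn2, hnx, hxn⟩ := exists_knot_interval hN hx₀
  have hcn : ¬ ZeroOn m c n := fun h => hne (by rw [h.splineSum_eq_zero hm hnx hxn, zero_mul])
  have hdn : ¬ ZeroOn m d n := fun h => hne (by rw [h.splineSum_eq_zero hm hnx hxn, mul_zero])
  -- A knot is a break if both splines vanish to order m there. The interval [a, b] reaches from n
  -- to the nearest break, or to the end of [N₁, N₂], on either side.
  obtain ⟨a, ha1, ha2, ha3, ha4⟩ := exists_last_le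
    (T := fun p => ∀ j, p - m ≤ j → j < p → c j = 0 ∧ d j = 0) hn1
  obtain ⟨b, hb1, hb2, hb3, hb4⟩ := exists_first_gt
    (T := fun p => ∀ j, p - m ≤ j → j < p → c j = 0 ∧ d j = 0) hn2
  obtain ⟨r, hr0, hr⟩ := exists_ne_zero_forall_add_mul_ne_zero (Finset.Icc (a - m) (b - 1)) c d
  -- Cutting at breaks leaves `c` and `d` unchanged on [a, b] and makes them zero on the rest of
  -- [N₁, N₂].
  set cut : (ℤ → ℝ) → ℤ → ℝ := fun e j => if a - m ≤ j ∧ j < b then e j else 0 with hcut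
  have cut_eq (e : ℤ → ℝ) (x : ℝ) (h1 : (a : ℝ) ≤ x) (h2 : x ≤ b) :
      splineSum m (cut e) x = splineSum m e x := by
    refine splineSum_congr hm fun j hj hj' => if_pos ⟨?_, ?_⟩
    · have : (a : ℝ) < j + m + 1 := by linarith
      have : a < j + m + 1 := by exact_mod_cast this
      omega
    · exact_mod_cast hj.trans_le h2
  have cut_zero (e : ℤ → ℝ) (he : ∀ j, c j = 0 ∧ d j = 0 → e j = 0) (x : ℝ)
      (hx : x ∈ Icc (N₁ : ℝ) N₂) (hx' : ¬ ((a : ℝ) ≤ x ∧ x ≤ b)) : splineSum m (cut e) x = 0 := by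
    refine splineSum_eq_zero_of_forall hm fun j hj hj' => ?_
    simp only [hcut]
    split_ifs with hab
    · refine he j ?_
      rw [not_and_or, not_le, not_le] at hx'
      rcases hx' with hx' | hx'
      · refine (ha3.resolve_left fun h => ?_) j hab.1 (by exact_mod_cast hj.trans hx')
        rw [h] at hx'
        linarith [hx.1]
      · refine (hb3.resolve_left fun h => ?_) j ?_ hab.2
        · rw [h] at hx'
          linarith [hx.2]
        · have : (b : ℝ) < j + m + 1 := by linarith
          have : b < j + m + 1 := by exact_mod_cast this
          omega
    · rfl
  have cutc := cut_zero c fun j h => h.1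
  have cutd := cut_zero d fun j h => h.2
  have cut_mul (x : ℝ) (hx : x ∈ E) :
      splineSum m (cut c) x * splineSum m (cut d) x = 0 := by
    by_cases hx' : (a : ℝ) ≤ x ∧ x ≤ b
    · rw [cut_eq c x hx'.1 hx'.2, cut_eq d x hx'.1 hx'.2, hcd x hx]
    · rw [cutc x (hE hx) hx', zero_mul]
  set F : ℤ → ℝ := fun j => cut c j + r * cut d j with hF
  have hFx (x : ℝ) : splineSum m F x = splineSum m (cut c) x + r * splineSum m (cut d) x := by
    rw [hF, splineSum_add hm, splineSum_mul]
  have hGx (x : ℝ) : splineSum m (fun j => cut c j - r * cut d j) x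
      = splineSum m (cut c) x - r * splineSum m (cut d) x := by
    rw [splineSum_sub hm, splineSum_mul]
  have hFzero (j : ℤ) (h1 : a - m ≤ j) (h2 : j < b) (h0 : F j = 0) : c j = 0 ∧ d j = 0 := by
    refine hr j (Finset.mem_Icc.2 ⟨h1, by omega⟩) ?_
    have h0' : cut c j + r * cut d j = 0 := h0
    rwa [show cut c j = c j from if_pos ⟨h1, h2⟩, show cut d j = d j from if_pos ⟨h1, h2⟩] at h0'
  clear_value F
  have key (e₁ e₂ : ℤ → ℝ)
      (hadd : ∀ x ∈ Icc (N₁ : ℝ) N₂, splineSum m F x = splineSum m e₁ x + splineSum m e₂ x)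
      (hmul : ∀ x ∈ Icc (N₁ : ℝ) N₂, splineSum m e₁ x * splineSum m e₂ x = 0)
      (h0 : ZeroOn m e₁ a) : indicator (Icc (N₁ : ℝ) N₂) (splineSum m e₁) = 0 := by
    have hmem (i : ℤ) (hi : a ≤ i) (hi' : i < b) (x : ℝ) (hx : x ∈ Ioo (i : ℝ) (i + 1)) :
        x ∈ Icc (N₁ : ℝ) N₂ := by
      have h1 : (N₁ : ℝ) ≤ i := by exact_mod_cast ha1.trans hi
      have h2 : (i : ℝ) + 1 ≤ N₂ := by exact_mod_cast (show i + 1 ≤ N₂ by omega)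
      exact ⟨by linarith [hx.1], by linarith [hx.2]⟩
    have hcoef (i : ℤ) (hi : a ≤ i) (hi' : i < b) :
        ZeroOn m (fun j => F j - (e₁ j + e₂ j)) i := by
      refine zeroOn_of_splineSum_eq_zero hm (lt_add_one (i : ℝ)) le_rfl le_rfl fun x hx => ?_
      rw [splineSum_sub hm, splineSum_add hm, hadd x (hmem i hi hi' x hx), sub_self]
    have hzero (i : ℤ) (hi : a ≤ i) : i < b → ZeroOn m e₁ i := by
      induction i, hi using Int.leInduction with
      | base => exact fun _ => h0
      | succ i hi ih =>
        intro hi'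
        by_contra hne₁
        have hz₂ : ZeroOn m e₂ (i + 1) := by
          by_contra hne₂
          obtain ⟨x, hx, hx0⟩ := exists_splineSum_mul_ne_zero hm hne₁ hne₂
          exact hx0 (hmul x (hmem _ (by omega) hi' x hx))
        -- If the vanishing summand changed at the knot i + 1, both would vanish to order m there,
        -- hence so would `F`; by the choice of r the knot would be a break inside (a, b).
        have hW : ∀ j, i + 1 - m ≤ j → j < i + 1 → c j = 0 ∧ d j = 0 := fun j hj hj' => by
          refine hFzero j (by omega) (by omega) ?_
          have h1 : F j - (e₁ j + e₂ j) = 0 := hcoef (i + 1) (by omega) hi' j hj hj'.le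
          rw [ih (by omega) j (by omega) (by omega), hz₂ j hj hj'.le] at h1
          simpa using h1
        by_cases hin : i + 1 ≤ n
        · exact ha4 _ (by omega) hin hW
        · exact hb4 _ (by omega) hi' hW
    ext x
    by_cases hx : x ∈ Icc (N₁ : ℝ) N₂
    · rw [indicator_of_mem hx, Pi.zero_apply]
      by_cases hx' : (a : ℝ) ≤ x ∧ x ≤ b
      · obtain ⟨i, hi, hi', hix, hxi⟩ := exists_knot_interval (ha2.trans_lt hb1) hx'
        exact (hzero i hi hi').splineSum_eq_zero hm hix hxi
      -- Outside [a, b] the sum is zero, so the summands are opposite and their zero product makes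
      -- both vanish.
      · have h1 := hadd x hx
        rw [hFx, cutc x hx hx', cutd x hx hx', mul_zero, add_zero] at h1
        have h2 := hmul x hx
        rw [show splineSum m e₂ x = -splineSum m e₁ x by linarith, mul_neg, neg_eq_zero] at h2
        exact mul_self_eq_zero.1 h2
    · rw [indicator_of_notMem hx, Pi.zero_apply]
  have hns : ¬ IsSeparableIn (restrictedSplineSpace m N₁ N₂)
      (indicator (Icc (N₁ : ℝ) N₂) (splineSum m F)) := by
    rintro ⟨f₁, hf₁, f₂, hf₂, hne₁, hne₂, hadd, hmul⟩
    obtain ⟨e₁, rfl⟩ := mem_restrictedSplineSpace.1 hf₁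
    obtain ⟨e₂, rfl⟩ := mem_restrictedSplineSpace.1 hf₂
    have hadd' : ∀ x ∈ Icc (N₁ : ℝ) N₂,
        splineSum m F x = splineSum m e₁ x + splineSum m e₂ x := fun x hx => by
      have := congrFun hadd x
      rwa [Pi.add_apply, indicator_of_mem hx, indicator_of_mem hx, indicator_of_mem hx] at this
    have hmul' : ∀ x ∈ Icc (N₁ : ℝ) N₂, splineSum m e₁ x * splineSum m e₂ x = 0 := fun x hx => by
      have := hmul x
      rwa [indicator_of_mem hx, indicator_of_mem hx] at this
    have hor : ZeroOn m e₁ a ∨ ZeroOn m e₂ a := by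
      by_contra! hnot
      obtain ⟨x, hx, hx0⟩ := exists_splineSum_mul_ne_zero hm hnot.1 hnot.2
      refine hx0 (hmul' x ⟨?_, ?_⟩)
      · have h1 : (N₁ : ℝ) ≤ a := by exact_mod_cast ha1
        linarith [hx.1]
      · have h2 : (a : ℝ) + 1 ≤ N₂ := by exact_mod_cast (show a + 1 ≤ N₂ by omega)
        linarith [hx.2]
    rcases hor with h0 | h0
    · exact hne₁ (key e₁ e₂ hadd' hmul' h0)
    · exact hne₂ (key e₂ e₁ (fun x hx => by rw [hadd' x hx, add_comm])
        (fun x hx => by rw [mul_comm, hmul' x hx]) h0)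
  -- The sum and the difference of c + rd and c - rd are 2c and 2rd, whose product vanishes on `E`.
  -- Equality up to sign would make d or c vanish on [a, b], but both are nonzero at a point of (n,
  -- n + 1).
  have hor := h _ (mem_restrictedSplineSpace.2 ⟨F, rfl⟩) hns _
    (mem_restrictedSplineSpace.2 ⟨fun j => cut c j - r * cut d j, rfl⟩) fun x hx => by
      rw [indicator_of_mem (hE hx), indicator_of_mem (hE hx), hFx, hGx,
        abs_eq_abs_iff_mul_eq_zero]
      linear_combination (-4 * r) * cut_mul x hx
  obtain ⟨x, hx, hx0⟩ := exists_splineSum_mul_ne_zero hm hcn hdn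
  have hax : (a : ℝ) ≤ x := by
    have : (a : ℝ) ≤ n := by exact_mod_cast ha2
    linarith [hx.1]
  have hxb : x ≤ b := by
    have : (n : ℝ) + 1 ≤ b := by exact_mod_cast hb1
    linarith [hx.2]
  have hxN : x ∈ Icc (N₁ : ℝ) N₂ := by
    have h1 : (N₁ : ℝ) ≤ a := by exact_mod_cast ha1
    have h2 : (b : ℝ) ≤ N₂ := by exact_mod_cast hb2
    exact ⟨by linarith, by linarith⟩
  rcases hor with h | h
  · have := congrFun h x
    rw [indicator_of_mem hxN, indicator_of_mem hxN, hFx, hGx, cut_eq c x hax hxb,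
      cut_eq d x hax hxb] at this
    have h2 : r * splineSum m d x = 0 := by linarith
    exact hx0 (by rw [(mul_eq_zero.1 h2).resolve_left hr0, mul_zero])
  · have := congrFun h x
    rw [Pi.neg_apply, indicator_of_mem hxN, indicator_of_mem hxN, hFx, hGx, cut_eq c x hax hxb,
      cut_eq d x hax hxb] at this
    exact hx0 (by rw [show splineSum m c x = 0 by linarith, zero_mul])

theorem theorem1 (m : ℕ) (hm : 1 ≤ m) (N₁ N₂ : ℤ) (hN : N₁ < N₂)
    (E : Set ℝ) (hE : E ⊆ Set.Icc (N₁ : ℝ) N₂) :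
    (IsPhaselessSampling (restrictedSplineSpace m N₁ N₂) E ↔ SatisfiesCounting m N₁ N₂ E) ∧
    (SatisfiesCounting m N₁ N₂ E →
      ∀ f₁ ∈ splineSpace m, ∀ f₂ ∈ splineSpace m,
        (∀ x ∈ E, |f₁ x| = |f₂ x|) → ∀ x ∈ Set.Icc (N₁ : ℝ) N₂, |f₁ x| = |f₂ x|) := by
  rw [satisfiesCounting_iff_counts hN hE]
  refine ⟨⟨fun h => (h.determinesProduct hm hN hE).counts hm hE,
    fun h => (h.determinesProduct hm hN).isPhaselessSampling hm hE⟩, fun h f₁ hf₁ f₂ hf₂ habs => ?_⟩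
  obtain ⟨c, rfl⟩ := mem_splineSpace.1 hf₁
  obtain ⟨d, rfl⟩ := mem_splineSpace.1 hf₂
  exact (h.determinesProduct hm hN).abs_eq_abs hm habs
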